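/- For a binary word $x = e_t\cdots e_2$ let $[x]=\sum_{2\le i\le t} e_iF_i$, where $F_i$ are the Fibonacci numbers; $x$ is a valid Fibonacci (Zeckendorf) representation if it does not contain $11$ (leading zeros are allowed). Words over $\{0,1\}^k$ are read as $k$ binary words in parallel, most significant digit first. First-order formulas over $\mathbb N$ that are built from the atoms $v=0$, $v=1$, $v+v'=v''$ by conjunction and existential quantification are translated into deterministic finite automata as follows. Each atom has a fixed automaton, independent of any constant $c$. A conjunction is translated by the product construction. An existential quantifier is translated by removing the component of the quantified variable (the start states of the resulting nondeterministic automaton are all states that are reachable on words that are zero in all other components) and by the subset construction, restricted to accessible subsets. Every deterministic automaton created is minimized (removal of inaccessible states, then Hopcroft's algorithm). Time is measured by the number of transitions traversed: the transitions of each automaton that is constructed; in the subset construction also the transitions of the nondeterministic automaton that leave the members of each subset; and in Hopcroft's algorithm, for each splitter (block $B$, letter $a$) that is processed, one plus the number of $a$-transitions into $B$. For $c\ge 0$ let $E_c(x)$, which expresses $x=c$, be $x=0$ if $c=0$; $\exists y\,(E_{c/2}(y)\wedge y+y=x)$ if $c>0$ is even; and $\exists y\,(E_{c-1}(y)\wedge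 y+1=x)$ if $c$ is odd, where $y+1=x$ stands for $\exists w\,(w=1\wedge y+w=x)$. Theorem. For every integer $c\ge 0$ the formula $\exists y\,(x+y=z\wedge E_c(y))$ expresses $x+c=z$, and its translation is the minimal deterministic automaton that accepts exactly the pairs of valid Fibonacci representations $x,z$ of equal length with $[x]+c=[z]$. The time for this construction is $O((\log^2 c)(\log\log c))$, where $\log c$ and $\log\log c$ are to be read as $1$ wherever they are undefined or less than $1$; that is, there is an absolute constant $C$ such that for all $c \ge 0$ the time is at most $C\,\max(1,\log c)^2\max(1,\log\log c)$. -/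

import Mathlib

namespace FibBuchi

/-! ### Fibonacci (Zeckendorf) representations, most significant digit first -/

/-- `[x] = ∑ eᵢ Fᵢ` for a binary word `x = e_t ⋯ e_2`: the last letter has weight `F_2 = 1`. -/
def fibVal : List Bool → ℕ
  | [] => 0
  | b :: x => (if b then Nat.fib (x.length + 2) else 0) + fibVal x

/-- A valid Fibonacci representation (leading zeros allowed): no two adjacent letters `1`. -/
def IsFibRep (x : List Bool) : Prop :=
  x.IsChain fun a b => ¬ (a = true ∧ b = true)

/-- The `i`-th component of a word over `{0,1}^k`. -/
def track {k : ℕ} (i : Fin k) (w : List (Fin k → Bool)) : List Bool :=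
  w.map fun a => a i

/-! ### Finite automata reading `k` words in parallel -/

/-- A finite (total) deterministic automaton over the alphabet `{0,1}^k`.
A dead state is a genuine state here, and is counted. -/
structure Auto (k : ℕ) where
  State : Type
  [fintypeState : Fintype State]
  dfa : DFA (Fin k → Bool) State

attribute [instance] Auto.fintypeState

/-- An automaton together with the time spent on constructing it. The unit of time is the
traversal of one transition. -/
structure Timed (k : ℕ) where
  aut : Auto k
  time : ℕ

noncomputable section

/-! ### Minimization: removal of inaccessible states, then Hopcroft's algorithm -/

section Minimization

variable {α σ : Type}

/-- The states of `M` that are reachable from its start state. -/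
abbrev Reach (M : DFA α σ) : Type := {q : σ // ∃ w : List α, M.eval w = q}

/-- The accessible part of a deterministic automaton. -/
def accessible (M : DFA α σ) : DFA α (Reach M) where
  step q a := ⟨M.step q.1 a, by
    obtain ⟨w, hw⟩ := q.2
    exact ⟨w ++ [a], by rw [DFA.eval_append_singleton, hw]⟩⟩
  start := ⟨M.start, [], rfl⟩
  accept := {q | q.1 ∈ M.accept}

variable [Fintype α] [Fintype σ]

/-- A configuration of Hopcroft's algorithm: the blocks of the current partition of the states,
the splitters (block, letter) that are still pending, and the time spent so far. -/
structure HopcroftConfig (α σ : Type) where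
  blocks : Finset (Finset σ)
  pending : Finset (Finset σ × α)
  time : ℕ

/-- The one of two blocks that has fewer states. -/
def smaller (A B : Finset σ) : Finset σ := if A.card ≤ B.card then A else B

open Classical in
/-- The sources of the transitions with label `a` into the block `B`. -/
def sources (M : DFA α σ) (B : Finset σ) (a : α) : Finset σ :=
  Finset.univ.filter fun q => M.step q a ∈ B

open Classical in
/-- Initially the blocks are the accepting and the non-accepting states, and the smaller of the
two is pending with every letter. -/
def hopcroftInit (M : DFA α σ) : HopcroftConfig α σ where
  blocks := ({Finset.univ.filter (fun q => q ∈ M.accept),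
    Finset.univ.filter (fun q => q ∉ M.accept)} : Finset (Finset σ)).filter (·.Nonempty)
  pending := Finset.univ.image fun a : α =>
    (smaller (Finset.univ.filter (fun q => q ∈ M.accept))
      (Finset.univ.filter (fun q => q ∉ M.accept)), a)
  time := 0

open Classical in
/-- The blocks after every block `C` has been split into `C ∩ X` and `C \ X`. -/
def splitBlocks (P : Finset (Finset σ)) (X : Finset σ) : Finset (Finset σ) :=
  (P.image (· ∩ X) ∪ P.image (· \ X)).filter (·.Nonempty)

open Classical in
/-- The pending splitters after that: a pending block that has been split is replaced by both of
its parts; of a block that has been split and was not pending with the letter `b`, the smaller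
part becomes pending with `b`. -/
def splitPending (P : Finset (Finset σ)) (W : Finset (Finset σ × α)) (X : Finset σ) :
    Finset (Finset σ × α) :=
  (W.image (fun p => (p.1 ∩ X, p.2)) ∪ W.image (fun p => (p.1 \ X, p.2))).filter (·.1.Nonempty) ∪
  ((P ×ˢ (Finset.univ : Finset α)).filter
    (fun p => p ∉ W ∧ (p.1 ∩ X).Nonempty ∧ (p.1 \ X).Nonempty)).image
    (fun p => (smaller (p.1 ∩ X) (p.1 \ X), p.2))

open Classical in
/-- One round of Hopcroft's algorithm: take a pending splitter `(B, a)`, traverse the transitions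
with label `a` into `B` backwards, and split all blocks by the set of their sources. If nothing is
pending, the algorithm has ended and nothing happens. -/
def hopcroftRound (M : DFA α σ) (s : HopcroftConfig α σ) : HopcroftConfig α σ :=
  if h : s.pending.Nonempty then
    let p := h.choose
    let X := sources M p.1 p.2
    { blocks := splitBlocks s.blocks X
      pending := splitPending s.blocks (s.pending.erase p) X
      time := s.time + 1 + X.card }
  else s

/-- The result of Hopcroft's algorithm. Every round takes one splitter from the pending ones, and
at most `|α| |σ|` splitters ever become pending, so that nothing is pending after that many
rounds. -/
def hopcroft (M : DFA α σ) : HopcroftConfig α σ :=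
  (hopcroftRound M)^[Fintype.card α * Fintype.card σ] (hopcroftInit M)

/-- Two states are identified if they lie in the same blocks. -/
def blockSetoid (P : Finset (Finset σ)) : Setoid σ where
  r p q := ∀ B ∈ P, p ∈ B ↔ q ∈ B
  iseqv := ⟨fun _ _ _ => Iff.rfl, fun h B hB => (h B hB).symm,
    fun h h' B hB => (h B hB).trans (h' B hB)⟩

/-- The automaton on the blocks, read off from one representative of each block. -/
def collapse (M : DFA α σ) (P : Finset (Finset σ)) : DFA α (Quotient (blockSetoid P)) where
  step b a := Quotient.mk _ (M.step b.out a)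
  start := Quotient.mk _ M.start
  accept := {b | b.out ∈ M.accept}

instance reachFintype (M : DFA α σ) : Fintype (Reach M) := Fintype.ofFinite _

instance collapseFintype (P : Finset (Finset σ)) : Fintype (Quotient (blockSetoid P)) :=
  Fintype.ofFinite _

end Minimization

/-- Minimization of `A`. Time: all transitions of `A` for finding the accessible states; the
transitions of the accessible part, traversed once to prepare the reversed transitions; the time of
Hopcroft's algorithm; the transitions of the resulting automaton. -/
def minimize {k : ℕ} (A : Auto k) : Timed k :=
  let M := accessible A.dfa
  let s := hopcroft M
  { aut := ⟨Quotient (blockSetoid s.blocks), collapse M s.blocks⟩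
    time := Fintype.card A.State * 2 ^ k + Fintype.card (Reach A.dfa) * 2 ^ k + s.time +
      Fintype.card (Quotient (blockSetoid s.blocks)) * 2 ^ k }

/-! ### Conjunction: the product construction -/

/-- The product automaton on `k` tracks; `A` reads the tracks `f 0, f 1, …` and `B` reads the
tracks `g 0, g 1, …`. -/
def product {i j k : ℕ} (f : Fin i → Fin k) (A : Auto i) (g : Fin j → Fin k) (B : Auto j) :
    Auto k :=
  ⟨A.State × B.State, (A.dfa.comap fun a => a ∘ f).inter (B.dfa.comap fun a => a ∘ g)⟩

/-- Conjunction: build the product (each of its transitions once), then minimize. -/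
def conjStep {i j k : ℕ} (f : Fin i → Fin k) (A : Timed i) (g : Fin j → Fin k) (B : Timed j) :
    Timed k :=
  let P := product f A.aut g B.aut
  let R := minimize P
  { aut := R.aut
    time := A.time + B.time + Fintype.card P.State * 2 ^ k + R.time }

/-! ### Existential quantification: projection and subset construction -/

/-- The nondeterministic automaton obtained by removing track `0` from the transitions. The start
states are those reachable from the old start state on words that are zero on all remaining tracks,
since the removed word may be longer than the representations on the remaining tracks. -/
def project {k : ℕ} (A : Auto (k + 1)) : NFA (Fin k → Bool) A.State where
  step q a := {r | ∃ b : Bool, A.dfa.step q (Fin.cons b a) = r}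
  start := {q | ∃ u : List Bool, A.dfa.eval (u.map fun b => Fin.cons b fun _ => false) = q}
  accept := A.dfa.accept

instance setStateFintype {k : ℕ} (A : Auto k) : Fintype (Set A.State) := Fintype.ofFinite _

/-- The accessible part of the subset automaton. -/
def determinize {k : ℕ} (A : Auto (k + 1)) : Auto k :=
  ⟨Reach (project A).toDFA, accessible (project A).toDFA⟩

/-- Existential quantification over track `0`. Time: all transitions of the given automaton, for
the projection; its transitions that are zero on the remaining tracks (two for each state), for the
start states; for each accessible subset `S` and each letter, one for the transition of the subset
automaton itself and two (one for each value of the removed digit) for each state in `S`; finally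
the minimization. -/
def exStep {k : ℕ} (A : Timed (k + 1)) : Timed k :=
  let D := determinize A.aut
  let R := minimize D
  { aut := R.aut
    time := A.time + Fintype.card A.aut.State * 2 ^ (k + 1) + Fintype.card A.aut.State * 2 +
      (∑ S : Reach (project A.aut).toDFA, ∑ _a : Fin k → Bool, (1 + 2 * S.1.ncard)) + R.time }

/-! ### The basic automata -/

/-- The automaton for `[x] = 0`: it accepts the words `0 ⋯ 0`. The state `false` is dead. -/
def zeroAuto : Auto 1 :=
  ⟨Bool, { step := fun q a => q && !a 0, start := true, accept := {true} }⟩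

/-- The automaton for `[x] = 1`: it accepts the words `0 ⋯ 0 1`. State `0` is the start state,
state `1` is reached after the letter `1`, and state `2` is dead. -/
def oneAuto : Auto 1 :=
  ⟨Fin 3, { step := fun q a => if q = 0 then (if a 0 then 1 else 0) else 2
            start := 0
            accept := {1} }⟩

/-- A state of the adder: the numbers `[x] + [y] - [z]` and `[x0] + [y0] - [z0]` for the words
`x`, `y`, `z` read so far (they determine the sequence `([x0ⁿ] + [y0ⁿ] - [z0ⁿ])ₙ`), and the last
letter read. -/
abbrev AddState : Type :=
  (Finset.Icc (-7 : ℤ) 7 × Finset.Icc (-7 : ℤ) 7) × (Fin 3 → Bool)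

open Classical in
/-- The transition function of the adder; `none` is the dead state. It is entered when one of the
three words contains `11`, and when one of the two numbers leaves the range from `-7` to `7`, in
which case the difference cannot return to zero. -/
def addStep : Option AddState → (Fin 3 → Bool) → Option AddState
  | none, _ => none
  | some s, a =>
    let u : ℤ := s.1.1
    let v : ℤ := s.1.2
    let t : ℤ := (a 0).toNat + (a 1).toNat - (a 2).toNat
    if ∃ i, s.2 i = true ∧ a i = true then none
    else if h : v + t ∈ Finset.Icc (-7 : ℤ) 7 ∧ u + v + 2 * t ∈ Finset.Icc (-7 : ℤ) 7 then
      some ((⟨v + t, h.1⟩, ⟨u + v + 2 * t, h.2⟩), a)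
    else none

/-- The adder: it reads `x`, `y`, `z` in parallel and checks `[x] + [y] = [z]`. -/
def addAuto : Auto 3 :=
  ⟨Option AddState,
    { step := addStep
      start := some ((⟨0, by decide⟩, ⟨0, by decide⟩), fun _ => false)
      accept := {q | ∃ s : AddState, q = some s ∧ (s.1.1 : ℤ) = 0} }⟩

end

/-! ### First-order formulas and their translation into automata -/

/-- First-order formulas in the free variables `v 0, …, v (k-1)`, ranging over the natural numbers,
built from `v 0 = 0`, `v 0 = 1`, `v 0 + v 1 = v 2` by conjunction and existential quantification.
In a conjunction the two subformulas are applied to the variables `v (f 0), v (f 1), …` and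
`v (g 0), v (g 1), …`, and each variable has to be used. The quantifier binds variable `0`. -/
inductive Formula : ℕ → Type
  | isZero : Formula 1
  | isOne : Formula 1
  | add : Formula 3
  | conj {i j k : ℕ} (f : Fin i → Fin k) (φ : Formula i) (g : Fin j → Fin k) (ψ : Formula j)
      (used : ∀ t : Fin k, (∃ s, f s = t) ∨ ∃ s, g s = t) : Formula k
  | ex {k : ℕ} (φ : Formula (k + 1)) : Formula k

/-- Truth of a formula in the natural numbers. -/
def Formula.Holds : {k : ℕ} → Formula k → (Fin k → ℕ) → Prop
  | _, .isZero, v => v 0 = 0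
  | _, .isOne, v => v 0 = 1
  | _, .add, v => v 0 + v 1 = v 2
  | _, .conj f φ g ψ _, v => φ.Holds (v ∘ f) ∧ ψ.Holds (v ∘ g)
  | _, .ex φ, v => ∃ n : ℕ, φ.Holds (Fin.cons n v)

/-- The translation of formulas into automata, by recursion on the formula, with its running time.
Every deterministic automaton that is created is minimized. -/
noncomputable def compile : {k : ℕ} → Formula k → Timed k
  | _, .isZero => minimize zeroAuto
  | _, .isOne => minimize oneAuto
  | _, .add => minimize addAuto
  | _, .conj f φ g ψ _ => conjStep f (compile φ) g (compile ψ)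
  | _, .ex φ => exStep (compile φ)

/-! ### The formulas for `x = c` and `x + c = z` -/

/-- `y + 1 = x` as a formula in `y, x`:  `∃ w, w = 1 ∧ y + w = x`. -/
def succFormula : Formula 2 :=
  .ex (.conj ![0] .isOne ![1, 0, 2] .add (by decide))

/-- `x = c`:  `x = 0` for `c = 0`;  `∃ y, y = c / 2 ∧ y + y = x` for even `c > 0`;
`∃ y, y = c - 1 ∧ y + 1 = x` for odd `c`. -/
def eqConst (c : ℕ) : Formula 1 :=
  if _h0 : c = 0 then .isZero
  else if _h2 : c % 2 = 0 then
    .ex (.conj (k := 2) ![0] (eqConst (c / 2)) ![0, 0, 1] .add (by decide))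
  else
    .ex (.conj (k := 2) ![0] (eqConst (c - 1)) ![0, 1] succFormula (by decide))
termination_by c
decreasing_by all_goals omega

/-- `x + c = z` as a formula in `x, z`:  `∃ y, x + y = z ∧ y = c`. -/
def addConst (c : ℕ) : Formula 2 :=
  .ex (.conj (k := 3) ![1, 0, 2] .add ![0] (eqConst c) (by decide))

end FibBuchi

namespace FibBuchi

/-! Correctness is an induction on the formula. The only delicate case is the quantifier, where a
witness may be longer than the free words; the start states of the projection supply the missing
leading zeros (`mem_project_eval`, `mem_compile_accepts`). Minimality holds because Hopcroft's
partition ends as Nerode equivalence (`sameBlocks_hopcroft`).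

The point of the time bound is that the subset construction does not blow up. Apart from the fixed
subformula `succFormula`, every quantifier binds a number `x₀` in a body that says `x₀ = c'`
together with one of three fixed linear equations `∑ βᵢ xᵢ = γ`. A prefix `W` acts on continuations
only through the last letters and the pairs `([x], [x0])` of its tracks, since `[xy] = F_{n+1}[x0] +
F_n[x] + [y]` for `|y| = n + 1`. For valid `x` the difference `[x0] - φ[x]` is bounded, `φ` the
golden ratio (`IsFibRep.fibShift_sub_bounds`). Hence along any prefix of a solution the linear form
and its shift stay bounded independently of `c'` (`exists_bound_lin`).

Two consequences follow. For fixed free tracks, the bounded linear form leaves boundedly many values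
for the bound track, so each subset has `O(1)` members (`exists_bound_ncard`). A live member of a
subset has as bound track a prefix of the padded representation of `c'`; its position there,
together with bounded data, determines the whole subset, so there are `O(log c')` subsets
(`exists_bound_card_reach`). This bound does not refer to the size of the automaton being projected,
so nothing accumulates along the recursion.

Hopcroft's algorithm costs `O(n log n)` by a potential argument (`hopcroft_time_le`). Each of the
`O(log c)` recursion steps therefore costs `O(log c · log log c)`, and the sum is the claimed bound.
-/

/-! ### Values of binary words -/

/-- The value `[x0]`. -/
def fibShift (x : List Bool) : ℕ := fibVal (x ++ [false])

/-- The last letter, `false` for the empty word. -/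
def lastBit (x : List Bool) : Bool := x.getLast?.getD false

theorem fibVal_replicate_append (n : ℕ) (x : List Bool) :
    fibVal (List.replicate n false ++ x) = fibVal x := by
  induction n with
  | zero => simp
  | succ n ih => simp [List.replicate_succ, fibVal, ih]

theorem fibVal_replicate (n : ℕ) : fibVal (List.replicate n false) = 0 := by
  simpa [fibVal] using fibVal_replicate_append n []

theorem fibShift_replicate_append (n : ℕ) (x : List Bool) :
    fibShift (List.replicate n false ++ x) = fibShift x := by
  simp only [fibShift, List.append_assoc, fibVal_replicate_append]

theorem lastBit_append_singleton (x : List Bool) (b : Bool) : lastBit (x ++ [b]) = b := by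
  simp [lastBit]

theorem lastBit_replicate_append (n : ℕ) (x : List Bool) :
    lastBit (List.replicate n false ++ x) = lastBit x := by
  induction x using List.reverseRecOn with
  | nil => cases n <;> simp [lastBit, List.getLast?_replicate]
  | append_singleton x b _ => rw [← List.append_assoc, lastBit_append_singleton,
      lastBit_append_singleton]

theorem fibVal_append (x y : List Bool) :
    fibVal (x ++ y) = fibVal (x ++ List.replicate y.length false) + fibVal y := by
  induction x with
  | nil => simp [fibVal_replicate]
  | cons b x ih => simp [fibVal, ih, add_assoc]

theorem fibVal_append_replicate_add_two (x : List Bool) (n : ℕ) :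
    fibVal (x ++ List.replicate (n + 2) false) =
      fibVal (x ++ List.replicate (n + 1) false) + fibVal (x ++ List.replicate n false) := by
  induction x with
  | nil => simp [fibVal_replicate]
  | cons b x ih =>
    simp only [List.cons_append, fibVal, ih, List.length_append, List.length_replicate]
    have : Nat.fib (x.length + (n + 2) + 2) =
        Nat.fib (x.length + n + 2) + Nat.fib (x.length + (n + 1) + 2) := by
      rw [show x.length + (n + 2) + 2 = (x.length + n + 2) + 2 by ring, Nat.fib_add_two]
      rfl
    split_ifs <;> omega

/-- The values `[x0ⁿ]` satisfy the Fibonacci recurrence, so they are combinations of the first two,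
`[x]` and `[x0]`. -/
theorem fibVal_append_replicate_succ (x : List Bool) (n : ℕ) :
    fibVal (x ++ List.replicate (n + 1) false) =
      Nat.fib (n + 1) * fibShift x + Nat.fib n * fibVal x := by
  induction n using Nat.strong_induction_on with
  | _ n ih =>
    match n with
    | 0 => simp [fibShift]
    | 1 =>
      have := fibVal_append_replicate_add_two x 0
      simp [fibShift] at this ⊢
      simpa using this
    | n + 2 =>
      rw [fibVal_append_replicate_add_two, ih (n + 1) (by omega), ih n (by omega),
        Nat.fib_add_two (n := n + 1), Nat.fib_add_two (n := n)]
      ring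

theorem fibVal_append_of_length (x y : List Bool) (n : ℕ) (h : y.length = n + 1) :
    fibVal (x ++ y) = Nat.fib (n + 1) * fibShift x + Nat.fib n * fibVal x + fibVal y := by
  rw [fibVal_append, h, fibVal_append_replicate_succ]

theorem fibVal_append_singleton (x : List Bool) (b : Bool) :
    fibVal (x ++ [b]) = fibShift x + b.toNat := by
  rw [fibVal_append_of_length x [b] 0 rfl]
  cases b <;> simp [fibVal]

theorem fibShift_append_singleton (x : List Bool) (b : Bool) :
    fibShift (x ++ [b]) = fibVal x + fibShift x + 2 * b.toNat := by
  rw [fibShift, List.append_assoc, fibVal_append_of_length x _ 1 rfl]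
  cases b <;> simp [fibVal, Nat.fib_add_two] <;> omega

theorem fibVal_append_congr {x x' : List Bool} (h : fibVal x = fibVal x')
    (h' : fibShift x = fibShift x') (y : List Bool) : fibVal (x ++ y) = fibVal (x' ++ y) := by
  rcases y.length.eq_zero_or_pos with hy | hy
  · simpa [List.length_eq_zero_iff.1 hy] using h
  · obtain ⟨n, hn⟩ := Nat.exists_eq_add_of_lt hy
    rw [zero_add] at hn
    rw [fibVal_append_of_length x y n hn, fibVal_append_of_length x' y n hn, h, h']

/-! ### Validity -/

theorem isFibRep_nil : IsFibRep [] := List.IsChain.nil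

theorem isFibRep_false_cons (x : List Bool) : IsFibRep (false :: x) ↔ IsFibRep x := by
  cases x <;> simp [IsFibRep]

theorem isFibRep_true_cons {x : List Bool} (h : IsFibRep (true :: x)) :
    IsFibRep x ∧ (x = [] ∨ ∃ y, x = false :: y) := by
  cases x with
  | nil => simp [IsFibRep]
  | cons b x => cases b <;> simp_all [IsFibRep]

/-- A prefix constrains its continuation only through its last letter. The default `false` for the
empty word is harmless because a leading zero constrains nothing. -/
theorem isFibRep_append (x y : List Bool) :
    IsFibRep (x ++ y) ↔ IsFibRep x ∧ IsFibRep (lastBit x :: y) := by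
  unfold IsFibRep lastBit
  rw [List.isChain_append]
  cases h : x.getLast? with
  | none =>
    have : x = [] := by simpa using h
    subst this
    cases y <;> simp
  | some b => cases y <;> simp [and_comm]

theorem isFibRep_replicate_append (n : ℕ) (x : List Bool) :
    IsFibRep (List.replicate n false ++ x) ↔ IsFibRep x := by
  induction n with
  | zero => simp
  | succ n ih => rw [List.replicate_succ, List.cons_append, isFibRep_false_cons, ih]

theorem isFibRep_append_singleton (x : List Bool) (b : Bool) :
    IsFibRep (x ++ [b]) ↔ IsFibRep x ∧ ¬ (lastBit x = true ∧ b = true) := by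
  rw [isFibRep_append]
  simp [IsFibRep]

/-! ### Zeckendorf's theorem -/

theorem IsFibRep.fibVal_lt {x : List Bool} (h : IsFibRep x) :
    fibVal x < Nat.fib (x.length + 2) := by
  induction hn : x.length using Nat.strong_induction_on generalizing x with
  | _ n ih =>
    match x with
    | [] => simp [fibVal]
    | false :: x =>
      have h' := ih x.length (by simp [← hn]) ((isFibRep_false_cons x).1 h) rfl
      have := Nat.fib_mono (show x.length + 2 ≤ n + 2 by simp [← hn])
      simp [fibVal]; omega
    | [true] => simp at hn; subst hn; simp [fibVal, Nat.fib_add_two]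
    | true :: true :: x => simp [IsFibRep] at h
    | true :: false :: x =>
      have h' := ih x.length (by simp [← hn])
        ((isFibRep_false_cons x).1 (isFibRep_true_cons h).1) rfl
      have : Nat.fib (x.length + 1 + 1 + 2) = Nat.fib (x.length + 2) + Nat.fib (x.length + 3) :=
        Nat.fib_add_two
      simp [fibVal, ← hn]; rw [this, add_comm]; exact Nat.add_lt_add_right h' _

/-- By `fibVal_lt` a tail never reaches the weight of the leading digit, so the value determines
that digit. -/
theorem IsFibRep.eq_of_length_eq {x y : List Bool} (hx : IsFibRep x) (hy : IsFibRep y)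
    (hl : x.length = y.length) (h : fibVal x = fibVal y) : x = y := by
  induction x generalizing y with
  | nil => simpa using hl.symm
  | cons a x ih =>
    obtain ⟨b, y, rfl⟩ := List.exists_cons_of_length_eq_add_one hl.symm
    have hl' : x.length = y.length := by simpa using hl
    have hxt : IsFibRep x := List.IsChain.tail hx
    have hyt : IsFibRep y := List.IsChain.tail hy
    have h1 := hxt.fibVal_lt
    have h2 := hyt.fibVal_lt
    rw [hl'] at h1
    have : a = b := by cases a <;> cases b <;> simp [fibVal, hl'] at h ⊢ <;> omega
    subst this
    rw [ih hxt hyt hl' (by simpa [fibVal, hl'] using h)]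

theorem exists_isFibRep_of_lt (t n : ℕ) (h : n < Nat.fib (t + 2)) :
    ∃ x, IsFibRep x ∧ x.length = t ∧ fibVal x = n := by
  induction t using Nat.strong_induction_on generalizing n with
  | _ t ih =>
    match t with
    | 0 => exact ⟨[], isFibRep_nil, rfl, by simp at h; simp [fibVal, h]⟩
    | 1 =>
      have : Nat.fib (1 + 2) = 2 := rfl
      have h' : n = 0 ∨ n = 1 := by omega
      rcases h' with rfl | rfl
      · exact ⟨[false], by simp [IsFibRep], rfl, rfl⟩
      · exact ⟨[true], by simp [IsFibRep], rfl, rfl⟩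
    | t + 2 =>
      by_cases hn : n < Nat.fib (t + 1 + 2)
      · obtain ⟨x, hx, hl, hv⟩ := ih (t + 1) (by omega) n hn
        exact ⟨false :: x, (isFibRep_false_cons x).2 hx, by simp [hl], by simp [fibVal, hv]⟩
      · have : Nat.fib (t + 2 + 2) = Nat.fib (t + 2) + Nat.fib (t + 1 + 2) := Nat.fib_add_two
        obtain ⟨x, hx, hl, hv⟩ := ih t (by omega) (n - Nat.fib (t + 1 + 2)) (by omega)
        refine ⟨true :: false :: x, ?_, by simp [hl], ?_⟩
        · have := (isFibRep_false_cons x).2 hx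
          unfold IsFibRep at this ⊢
          simpa using this
        · simp [fibVal, hv, hl]; omega

/-- Fibonacci numbers at least double every two indices, so twice as many Fibonacci digits as binary
digits suffice. -/
theorem lt_fib_two_mul_size (n : ℕ) : n < Nat.fib (2 * n.size + 2) := by
  have h : ∀ s, 2 ^ s ≤ Nat.fib (2 * s + 2) := by
    intro s
    induction s with
    | zero => simp
    | succ s ih =>
      have h1 : Nat.fib (2 * (s + 1) + 2) = Nat.fib (2 * s + 2) + Nat.fib (2 * s + 3) :=
        Nat.fib_add_two
      have h2 := Nat.fib_mono (show 2 * s + 2 ≤ 2 * s + 3 by omega)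
      rw [pow_succ]; omega
  exact (Nat.lt_size_self n).trans_le (h _)

theorem exists_isFibRep (n : ℕ) :
    ∃ x, IsFibRep x ∧ x.length = 2 * n.size ∧ fibVal x = n :=
  exists_isFibRep_of_lt _ n (lt_fib_two_mul_size n)

/-- Representations of the same number agree up to leading zeros. -/
theorem IsFibRep.pad_eq {x y : List Bool} (hx : IsFibRep x) (hy : IsFibRep y)
    (h : fibVal x = fibVal y) :
    List.replicate y.length false ++ x = List.replicate x.length false ++ y := by
  apply IsFibRep.eq_of_length_eq
  · rwa [isFibRep_replicate_append]
  · rwa [isFibRep_replicate_append]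
  · simp [add_comm]
  · rwa [fibVal_replicate_append, fibVal_replicate_append]

theorem IsFibRep.fibShift_eq {x y : List Bool} (hx : IsFibRep x) (hy : IsFibRep y)
    (h : fibVal x = fibVal y) : fibShift x = fibShift y := by
  rw [← fibShift_replicate_append y.length x, hx.pad_eq hy h, fibShift_replicate_append]

theorem IsFibRep.lastBit_eq {x y : List Bool} (hx : IsFibRep x) (hy : IsFibRep y)
    (h : fibVal x = fibVal y) : lastBit x = lastBit y := by
  rw [← lastBit_replicate_append y.length x, hx.pad_eq hy h, lastBit_replicate_append]

/-! ### The shift is close to multiplication by the golden ratio -/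

/-- Appending the digit `b` maps the error `e = [x0] - g[x]` to `(1 - g)e + (2 - g)b`, a contraction
since `|1 - g| < 1`. The stated intervals are invariant: a digit `1` can only follow a last digit
`0`, where the smaller upper bound `2g - 3` is available. -/
theorem IsFibRep.fibShift_sub_bounds {g : ℝ} (hg : g ^ 2 = g + 1) (h1 : 1.6 < g) (h2 : g < 1.7)
    {x : List Bool} (hx : IsFibRep x) :
    g - 2 ≤ fibShift x - g * fibVal x ∧
      fibShift x - g * fibVal x ≤ if lastBit x then g - 1 else 2 * g - 3 := by
  induction x using List.reverseRecOn with
  | nil =>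
    norm_num [fibShift, fibVal, lastBit]
    constructor <;> linarith
  | append_singleton x b ih =>
    rw [isFibRep_append_singleton] at hx
    obtain ⟨l, u⟩ := ih hx.1
    have key : (fibShift (x ++ [b]) : ℝ) - g * fibVal (x ++ [b]) =
        (1 - g) * (fibShift x - g * fibVal x) + (2 - g) * b.toNat := by
      rw [fibShift_append_singleton, fibVal_append_singleton]
      push_cast
      linear_combination -(fibVal x : ℝ) * hg
    rw [key, lastBit_append_singleton]
    generalize (fibShift x : ℝ) - g * fibVal x = e at l u
    cases b with
    | false =>
      have u' : e ≤ g - 1 := u.trans (by split_ifs <;> linarith)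
      simp
      constructor <;> nlinarith
    | true =>
      have : lastBit x = false := by simpa using hx.2
      rw [this] at u
      simp at u ⊢
      constructor <;> nlinarith

theorem goldenRatio_bounds : 1.6 < Real.goldenRatio ∧ Real.goldenRatio < 1.62 := by
  have h := Real.goldenRatio_sq
  have h0 := Real.one_lt_goldenRatio
  constructor <;> nlinarith

/-! ### Hopcroft's algorithm -/

section Hopcroft

set_option linter.unusedSectionVars false

open scoped Classical

variable {α σ : Type} [Fintype α] [Fintype σ]

/-- Two states lie in the same blocks. -/
def SameBlocks (P : Finset (Finset σ)) (p q : σ) : Prop := ∀ B ∈ P, p ∈ B ↔ q ∈ B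

theorem mem_sources {M : DFA α σ} {B : Finset σ} {a : α} {q : σ} :
    q ∈ sources M B a ↔ M.step q a ∈ B := by
  simp [sources]

theorem mem_splitBlocks {P : Finset (Finset σ)} {X T : Finset σ} :
    T ∈ splitBlocks P X ↔ T.Nonempty ∧ ∃ S ∈ P, S ∩ X = T ∨ S \ X = T := by
  simp only [splitBlocks, Finset.mem_filter, Finset.mem_union, Finset.mem_image]
  constructor
  · rintro ⟨⟨S, hS, h⟩ | ⟨S, hS, h⟩, hT⟩
    · exact ⟨hT, S, hS, .inl h⟩
    · exact ⟨hT, S, hS, .inr h⟩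
  · rintro ⟨hT, S, hS, h | h⟩
    · exact ⟨.inl ⟨S, hS, h⟩, hT⟩
    · exact ⟨.inr ⟨S, hS, h⟩, hT⟩

theorem mem_splitPending {P : Finset (Finset σ)} {W : Finset (Finset σ × α)} {X T : Finset σ}
    {a : α} : (T, a) ∈ splitPending P W X ↔
      (T.Nonempty ∧ ∃ S, (S, a) ∈ W ∧ (S ∩ X = T ∨ S \ X = T)) ∨
      ∃ S ∈ P, (S, a) ∉ W ∧ (S ∩ X).Nonempty ∧ (S \ X).Nonempty ∧
        smaller (S ∩ X) (S \ X) = T := by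
  simp only [splitPending, Finset.mem_filter, Finset.mem_union, Finset.mem_image,
    Finset.mem_product, Finset.mem_univ, and_true, Prod.exists, Prod.mk.injEq]
  constructor
  · rintro (⟨⟨S, b, hS, h, rfl⟩ | ⟨S, b, hS, h, rfl⟩, hT⟩ | ⟨S, b, ⟨hS, h⟩, h', rfl⟩)
    · exact .inl ⟨hT, S, hS, .inl h⟩
    · exact .inl ⟨hT, S, hS, .inr h⟩
    · exact .inr ⟨S, hS, h.1, h.2.1, h.2.2, h'⟩
  · rintro (⟨hT, S, hS, h | h⟩ | ⟨S, hS, h, h1, h2, h3⟩)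
    · exact .inl ⟨.inl ⟨S, a, hS, h, rfl⟩, hT⟩
    · exact .inl ⟨.inr ⟨S, a, hS, h, rfl⟩, hT⟩
    · exact .inr ⟨S, a, ⟨hS, h, h1, h2⟩, h3, rfl⟩

theorem smaller_eq_or (A B : Finset σ) :
    (smaller A B = A ∧ A.card ≤ B.card) ∨ (smaller A B = B ∧ B.card ≤ A.card) := by
  unfold smaller
  split_ifs with h
  · exact .inl ⟨rfl, h⟩
  · exact .inr ⟨rfl, by omega⟩

/-- The blocks partition the states, and the pending splitters are blocks or empty. -/
structure IsPartition (P : Finset (Finset σ)) (W : Finset (Finset σ × α)) : Prop where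
  nonempty : ∀ B ∈ P, B.Nonempty
  eq_of_mem : ∀ B ∈ P, ∀ B' ∈ P, ∀ x, x ∈ B → x ∈ B' → B = B'
  cover : ∀ x, ∃ B ∈ P, x ∈ B
  pending : ∀ S a, (S, a) ∈ W → S ∈ P ∨ S = ∅

theorem IsPartition.split {P : Finset (Finset σ)} {W : Finset (Finset σ × α)}
    (h : IsPartition P W) (X : Finset σ) :
    IsPartition (splitBlocks P X) (splitPending P W X) where
  nonempty B hB := (mem_splitBlocks.1 hB).1
  eq_of_mem B hB B' hB' x hx hx' := by
    obtain ⟨-, S, hS, h1⟩ := mem_splitBlocks.1 hB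
    obtain ⟨-, S', hS', h2⟩ := mem_splitBlocks.1 hB'
    have e : S = S' := by
      refine h.eq_of_mem S hS S' hS' x ?_ ?_
      · rcases h1 with rfl | rfl <;> simp_all
      · rcases h2 with rfl | rfl <;> simp_all
    subst e
    rcases h1 with rfl | rfl <;> rcases h2 with rfl | rfl <;> simp_all
  cover x := by
    obtain ⟨B, hB, hx⟩ := h.cover x
    by_cases hX : x ∈ X
    · exact ⟨B ∩ X, mem_splitBlocks.2 ⟨⟨x, by simp [hx, hX]⟩, B, hB, .inl rfl⟩, by simp [hx, hX]⟩
    · exact ⟨B \ X, mem_splitBlocks.2 ⟨⟨x, by simp [hx, hX]⟩, B, hB, .inr rfl⟩, by simp [hx, hX]⟩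
  pending T a hT := by
    rcases mem_splitPending.1 hT with ⟨hne, S, hS, h'⟩ | ⟨S, hS, -, h1, h2, h3⟩
    · rcases h.pending S a hS with hP | rfl
      · exact .inl (mem_splitBlocks.2 ⟨hne, S, hP, h'⟩)
      · rcases h' with rfl | rfl <;> simp at hne
    · left
      rcases smaller_eq_or (S ∩ X) (S \ X) with ⟨e, -⟩ | ⟨e, -⟩
      · exact mem_splitBlocks.2 ⟨by rwa [← h3, e], S, hS, .inl (e.symm.trans h3)⟩
      · exact mem_splitBlocks.2 ⟨by rwa [← h3, e], S, hS, .inr (e.symm.trans h3)⟩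

theorem IsPartition.mono {P : Finset (Finset σ)} {W W' : Finset (Finset σ × α)}
    (h : IsPartition P W) (hW : W' ⊆ W) : IsPartition P W' :=
  { h with pending := fun S a hS => h.pending S a (hW hS) }

theorem IsPartition.sameBlocks_split {P : Finset (Finset σ)} {W : Finset (Finset σ × α)}
    (h : IsPartition P W) (X : Finset σ) (p q : σ) :
    SameBlocks (splitBlocks P X) p q ↔ SameBlocks P p q ∧ (p ∈ X ↔ q ∈ X) := by
  constructor
  · intro hs
    have key : ∀ B ∈ P, (p ∈ B ∩ X ↔ q ∈ B ∩ X) ∧ (p ∈ B \ X ↔ q ∈ B \ X) := by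
      refine fun B hB => ⟨?_, ?_⟩
      · rcases (B ∩ X).eq_empty_or_nonempty with e | e
        · simp only [e, Finset.notMem_empty]
        · exact hs _ (mem_splitBlocks.2 ⟨e, B, hB, .inl rfl⟩)
      · rcases (B \ X).eq_empty_or_nonempty with e | e
        · simp only [e, Finset.notMem_empty]
        · exact hs _ (mem_splitBlocks.2 ⟨e, B, hB, .inr rfl⟩)
    simp only [Finset.mem_inter, Finset.mem_sdiff] at key
    refine ⟨fun B hB => by have := key B hB; tauto, ?_⟩
    obtain ⟨B, hB, hp⟩ := h.cover p
    have := key B hB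
    tauto
  · rintro ⟨hs, hX⟩ T hT
    obtain ⟨-, S, hS, rfl | rfl⟩ := mem_splitBlocks.1 hT
    · simp [hs S hS, hX]
    · simp [hs S hS, hX]

/-- The invariant of Hopcroft's algorithm. -/
structure HopcroftInv (M : DFA α σ) (P : Finset (Finset σ)) (W : Finset (Finset σ × α)) : Prop
    extends IsPartition P W where
  sameBlocks_of_equiv : ∀ p q, M.acceptsFrom p = M.acceptsFrom q → SameBlocks P p q
  accept : ∀ p q, SameBlocks P p q → (p ∈ M.accept ↔ q ∈ M.accept)
  stable : ∀ a p q, SameBlocks P p q →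
    (∀ S, (S, a) ∈ W → (M.step p a ∈ S ↔ M.step q a ∈ S)) → SameBlocks P (M.step p a) (M.step q a)

theorem acceptsFrom_step_eq {M : DFA α σ} {p q : σ} (h : M.acceptsFrom p = M.acceptsFrom q)
    (a : α) : M.acceptsFrom (M.step p a) = M.acceptsFrom (M.step q a) := by
  ext w
  exact iff_of_eq (congrArg (fun L : Language α => (a :: w) ∈ L) h)

/-- Splitting by the sources of a block separates only inequivalent states. Stability survives
although only one part of a non-pending split block becomes pending: two successors already known to
lie in the same old block are separated by one part exactly when they are separated by the other. -/
theorem HopcroftInv.round {M : DFA α σ} {P : Finset (Finset σ)} {W : Finset (Finset σ × α)}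
    (h : HopcroftInv M P W) {p : Finset σ × α} (hp : p ∈ W) :
    HopcroftInv M (splitBlocks P (sources M p.1 p.2))
      (splitPending P (W.erase p) (sources M p.1 p.2)) := by
  have hpart : IsPartition P (W.erase p) := h.toIsPartition.mono (Finset.erase_subset _ _)
  refine { hpart.split _ with
    sameBlocks_of_equiv := ?_, accept := ?_, stable := ?_ }
  · intro r s hrs
    rw [hpart.sameBlocks_split]
    refine ⟨h.sameBlocks_of_equiv r s hrs, ?_⟩
    rw [mem_sources, mem_sources]
    rcases h.pending p.1 p.2 hp with hP | hP
    · exact h.sameBlocks_of_equiv _ _ (acceptsFrom_step_eq hrs _) _ hP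
    · simp [hP]
  · intro r s hrs
    exact h.accept r s ((hpart.sameBlocks_split _ r s).1 hrs).1
  · intro a r s hrs hW
    obtain ⟨h1, h2⟩ := (hpart.sameBlocks_split _ r s).1 hrs
    rw [mem_sources, mem_sources] at h2
    have hold : SameBlocks P (M.step r a) (M.step s a) := by
      refine h.stable a r s h1 fun S hS => ?_
      -- The processed splitter no longer separates `r` and `s`, because the blocks have just been
      -- split by its sources; any other old splitter survives through its two parts.
      by_cases e : (S, a) = p
      · subst e; exact h2
      have hS' : (S, a) ∈ W.erase p := Finset.mem_erase.2 ⟨e, hS⟩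
      have key : ∀ T, (S ∩ sources M p.1 p.2 = T ∨ S \ sources M p.1 p.2 = T) →
          (M.step r a ∈ T ↔ M.step s a ∈ T) := by
        intro T hT
        rcases T.eq_empty_or_nonempty with rfl | hne
        · simp
        · exact hW T (mem_splitPending.2 (.inl ⟨hne, S, hS', hT⟩))
      have k1 := key _ (.inl rfl)
      have k2 := key _ (.inr rfl)
      simp only [Finset.mem_inter, Finset.mem_sdiff] at k1 k2
      tauto
    rw [hpart.sameBlocks_split]
    refine ⟨hold, ?_⟩
    set X := sources M p.1 p.2
    obtain ⟨B, hB, hr⟩ := h.cover (M.step r a)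
    have hs := (hold B hB).1 hr
    by_cases n1 : (B ∩ X).Nonempty
    · by_cases n2 : (B \ X).Nonempty
      · by_cases hBW : (B, a) ∈ W.erase p
        · have := hW _ (mem_splitPending.2 (.inl ⟨n1, B, hBW, .inl rfl⟩))
          simpa [hr, hs] using this
        · have := hW _ (mem_splitPending.2 (.inr ⟨B, hB, hBW, n1, n2, rfl⟩))
          rcases smaller_eq_or (B ∩ X) (B \ X) with ⟨e, -⟩ | ⟨e, -⟩
          · rw [e] at this; simpa [hr, hs] using this
          · rw [e] at this
            simp only [Finset.mem_sdiff, hr, hs, true_and] at this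
            exact not_iff_not.1 this
      · rw [Finset.not_nonempty_iff_eq_empty, Finset.sdiff_eq_empty_iff_subset] at n2
        exact iff_of_true (n2 hr) (n2 hs)
    · rw [Finset.not_nonempty_iff_eq_empty, ← Finset.disjoint_iff_inter_eq_empty] at n1
      exact iff_of_false (Finset.disjoint_left.1 n1 hr) (Finset.disjoint_left.1 n1 hs)

/-- The data of the initial configuration, with the smaller of the two blocks named. -/
theorem hopcroftInit_eq (M : DFA α σ) : ∃ A B : Finset σ,
    (∀ q, q ∈ A ↔ q ∉ B) ∧ B.Nonempty ∧
    ((∀ q, q ∈ A ↔ q ∈ M.accept) ∨ (∀ q, q ∈ B ↔ q ∈ M.accept)) ∧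
    (∀ S, S ∈ (hopcroftInit M).blocks ↔ S.Nonempty ∧ (S = A ∨ S = B)) ∧
    (∀ S a, (S, a) ∈ (hopcroftInit M).pending ↔ S = A) ∧ (hopcroftInit M).time = 0 := by
  set F : Finset σ := Finset.univ.filter (fun q => q ∈ M.accept) with hF
  set G : Finset σ := Finset.univ.filter (fun q => q ∉ M.accept) with hG
  have hne : F.Nonempty ∨ G.Nonempty := by
    by_cases h : M.start ∈ M.accept
    · exact .inl ⟨M.start, by simp [hF, h]⟩
    · exact .inr ⟨M.start, by simp [hG, h]⟩
  rcases smaller_eq_or F G with ⟨e, hc⟩ | ⟨e, hc⟩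
  · refine ⟨F, G, by simp [hF, hG], ?_, .inl (by simp [hF]), ?_, ?_, rfl⟩
    · rcases hne with h | h
      · exact Finset.card_pos.1 ((Finset.card_pos.2 h).trans_le hc)
      · exact h
    · intro S
      simp only [hopcroftInit, ← hF, ← hG, Finset.mem_filter, Finset.mem_insert,
        Finset.mem_singleton, and_comm]
    · intro S a
      simp only [hopcroftInit, ← hF, ← hG, e, Finset.mem_image, Finset.mem_univ, true_and,
        Prod.mk.injEq]
      simp [eq_comm]
  · refine ⟨G, F, by simp [hF, hG], ?_, .inr (by simp [hF]), ?_, ?_, rfl⟩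
    · rcases hne with h | h
      · exact h
      · exact Finset.card_pos.1 ((Finset.card_pos.2 h).trans_le hc)
    · intro S
      simp only [hopcroftInit, ← hF, ← hG, Finset.mem_filter, Finset.mem_insert,
        Finset.mem_singleton, and_comm, or_comm]
    · intro S a
      simp only [hopcroftInit, ← hF, ← hG, e, Finset.mem_image, Finset.mem_univ, true_and,
        Prod.mk.injEq]
      simp [eq_comm]

/-- The two initial blocks are complementary, so a letter that respects the pending one respects the
other as well. -/
theorem hopcroftInv_init (M : DFA α σ) :
    HopcroftInv M (hopcroftInit M).blocks (hopcroftInit M).pending := by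
  obtain ⟨A, B, hAB, -, hacc, hP, hW, -⟩ := hopcroftInit_eq M
  have same : ∀ p q, SameBlocks (hopcroftInit M).blocks p q ↔
      (p ∈ M.accept ↔ q ∈ M.accept) := by
    intro p q
    constructor
    · intro h
      have hA : p ∈ A ↔ q ∈ A := by
        rcases A.eq_empty_or_nonempty with e | e
        · simp [e]
        · exact h A ((hP A).2 ⟨e, .inl rfl⟩)
      rcases hacc with h | h
      · rw [← h, ← h, hA]
      · rw [← h, ← h, ← not_iff_not, ← hAB, ← hAB, hA]
    · intro h S hS
      have hA : p ∈ A ↔ q ∈ A := by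
        rcases hacc with h' | h'
        · rw [h', h', h]
        · rw [hAB, hAB, not_iff_not, h', h', h]
      rcases ((hP S).1 hS).2 with rfl | rfl
      · exact hA
      · rwa [hAB, hAB, not_iff_not] at hA
  refine ⟨⟨fun S hS => ((hP S).1 hS).1, ?_, ?_, ?_⟩, ?_, ?_, ?_⟩
  · intro S hS S' hS' x hx hx'
    rcases ((hP S).1 hS).2 with rfl | rfl <;> rcases ((hP S').1 hS').2 with rfl | rfl
    · rfl
    · exact absurd hx' ((hAB x).1 hx)
    · exact absurd hx ((hAB x).1 hx')
    · rfl
  · intro x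
    by_cases hx : x ∈ A
    · exact ⟨A, (hP A).2 ⟨⟨x, hx⟩, .inl rfl⟩, hx⟩
    · have hx' : x ∈ B := by simpa [hAB] using hx
      exact ⟨B, (hP B).2 ⟨⟨x, hx'⟩, .inr rfl⟩, hx'⟩
  · intro S a hS
    rw [hW] at hS
    subst hS
    rcases S.eq_empty_or_nonempty with e | e
    · exact .inr e
    · exact .inl ((hP S).2 ⟨e, .inl rfl⟩)
  · intro p q h
    exact (same p q).2 (iff_of_eq (congrArg (fun L : Language α => [] ∈ L) h))
  · exact fun p q h => (same p q).1 h
  · intro a p q _ h S hS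
    have hA := h A ((hW A a).2 rfl)
    rcases ((hP S).1 hS).2 with rfl | rfl
    · exact hA
    · rwa [hAB, hAB, not_iff_not] at hA

theorem hopcroftRound_of_nonempty (M : DFA α σ) (s : HopcroftConfig α σ)
    (h : s.pending.Nonempty) : ∃ p ∈ s.pending, hopcroftRound M s =
      { blocks := splitBlocks s.blocks (sources M p.1 p.2)
        pending := splitPending s.blocks (s.pending.erase p) (sources M p.1 p.2)
        time := s.time + 1 + (sources M p.1 p.2).card } :=
  ⟨h.choose, h.choose_spec, by rw [hopcroftRound, dif_pos h]⟩

theorem hopcroftRound_of_empty (M : DFA α σ) (s : HopcroftConfig α σ)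
    (h : s.pending = ∅) : hopcroftRound M s = s := by
  rw [hopcroftRound, dif_neg (by simp [h])]

theorem HopcroftInv.hopcroftRound {M : DFA α σ} {s : HopcroftConfig α σ}
    (h : HopcroftInv M s.blocks s.pending) :
    HopcroftInv M (FibBuchi.hopcroftRound M s).blocks (FibBuchi.hopcroftRound M s).pending := by
  rcases s.pending.eq_empty_or_nonempty with e | e
  · rwa [hopcroftRound_of_empty M s e]
  · obtain ⟨p, hp, hr⟩ := hopcroftRound_of_nonempty M s e
    rw [hr]
    exact h.round hp

theorem hopcroftInv_iterate (M : DFA α σ) (n : ℕ) :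
    HopcroftInv M ((FibBuchi.hopcroftRound M)^[n] (hopcroftInit M)).blocks
      ((FibBuchi.hopcroftRound M)^[n] (hopcroftInit M)).pending := by
  induction n with
  | zero => exact hopcroftInv_init M
  | succ n ih => rw [Function.iterate_succ_apply']; exact ih.hopcroftRound

/-! ### Potentials -/

/-- A potential that charges each block, with each letter, depending on whether it is pending. -/
noncomputable def potential (g : Finset σ → α → Bool → ℕ) (P : Finset (Finset σ))
    (W : Finset (Finset σ × α)) : ℕ :=
  ∑ x ∈ insert ∅ P ×ˢ Finset.univ, g x.1 x.2 (decide (x ∈ W))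

/-- A charge that does not increase when blocks are split in the manner of Hopcroft. -/
structure IsCharge (g : Finset σ → α → Bool → ℕ) : Prop where
  mono : ∀ A a, g A a false ≤ g A a true
  both : ∀ A B a, A.Nonempty → B.Nonempty → Disjoint A B →
    g A a true + g B a true ≤ g (A ∪ B) a true
  smaller : ∀ A B a, A.Nonempty → B.Nonempty → Disjoint A B → A.card ≤ B.card →
    g A a true + g B a false ≤ g (A ∪ B) a false

/-- The local form of `potential_split_le`. A nonempty part has a unique parent block, so its
pending status is governed by that of `S`: if `S` was pending, `both` applies; if not, only the part
chosen by `smaller` is pending, and the field `smaller` applies; a trivial split leaves the status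
of a non-pending `S` unchanged. -/
theorem IsCharge.parts_le {g : Finset σ → α → Bool → ℕ} (hg : IsCharge g)
    {P : Finset (Finset σ)} {W : Finset (Finset σ × α)} (h : IsPartition P W) (X : Finset σ)
    (a : α) {S : Finset σ} (hS : S ∈ P) :
    ∑ T ∈ ({S ∩ X, S \ X} : Finset (Finset σ)).filter (·.Nonempty),
      g T a (decide ((T, a) ∈ splitPending P W X)) ≤ g S a (decide ((S, a) ∈ W)) := by
  have mono' : ∀ A (b : Bool), g A a b ≤ g A a true := fun A b => by
    cases b
    · exact hg.mono A a
    · exact le_rfl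
  have owner : ∀ S' ∈ P, ∀ T, T.Nonempty → (S ∩ X = T ∨ S \ X = T) →
      (S' ∩ X = T ∨ S' \ X = T) → S' = S := by
    rintro S' hS' T ⟨x, hx⟩ h1 h2
    refine h.eq_of_mem S' hS' S hS x ?_ ?_
    · rcases h2 with rfl | rfl <;> simp_all
    · rcases h1 with rfl | rfl <;> simp_all
  have pend : ∀ T, T.Nonempty → (S ∩ X = T ∨ S \ X = T) → (T, a) ∈ splitPending P W X →
      (S, a) ∉ W → (S ∩ X).Nonempty ∧ (S \ X).Nonempty ∧
        FibBuchi.smaller (S ∩ X) (S \ X) = T := by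
    intro T hT hST hmem hSW
    rcases mem_splitPending.1 hmem with ⟨-, S', hS', h'⟩ | ⟨S', hS', -, h1, h2, h3⟩
    · rcases h.pending S' a hS' with hP | rfl
      · rw [owner S' hP T hT hST h'] at hS'
        exact absurd hS' hSW
      · exfalso
        rcases h' with rfl | rfl <;> simp at hT
    · have h' : S' ∩ X = T ∨ S' \ X = T := by
        rcases smaller_eq_or (S' ∩ X) (S' \ X) with ⟨e, -⟩ | ⟨e, -⟩
        · exact .inl (e.symm.trans h3)
        · exact .inr (e.symm.trans h3)
      rw [owner S' hS' T hT hST h'] at h1 h2 h3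
      exact ⟨h1, h2, h3⟩
  have hdisj : Disjoint (S ∩ X) (S \ X) := by
    rw [Finset.disjoint_left]; intro x; simp; tauto
  have hunion : (S ∩ X) ∪ (S \ X) = S := by
    rw [Finset.union_comm]; exact Finset.sdiff_union_inter S X
  have single : ∀ T, T = S → (S ∩ X = T ∨ S \ X = T) → ¬((S ∩ X).Nonempty ∧ (S \ X).Nonempty) →
      g T a (decide ((T, a) ∈ splitPending P W X)) ≤ g S a (decide ((S, a) ∈ W)) := by
    rintro T rfl hT hnot
    by_cases hW : (T, a) ∈ W
    · simpa [hW] using mono' _ _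
    · have : (T, a) ∉ splitPending P W X := fun hm => hnot
        ⟨(pend T (h.nonempty T hS) hT hm hW).1, (pend T (h.nonempty T hS) hT hm hW).2.1⟩
      simp [hW, this]
  rcases (S ∩ X).eq_empty_or_nonempty with e1 | e1
  · have e2 : S \ X = S := by rw [e1, Finset.empty_union] at hunion; exact hunion
    rw [e1, e2, show ({∅, S} : Finset (Finset σ)).filter (·.Nonempty) = {S} by
      ext T; simp; constructor
      · rintro ⟨rfl | rfl, h⟩
        · simp at h
        · rfl
      · rintro rfl; exact ⟨.inr rfl, h.nonempty _ hS⟩, Finset.sum_singleton]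
    exact single S rfl (.inr e2) (by simp [e1])
  rcases (S \ X).eq_empty_or_nonempty with e2 | e2
  · have e3 : S ∩ X = S := by rw [e2, Finset.union_empty] at hunion; exact hunion
    rw [e2, e3, show ({S, ∅} : Finset (Finset σ)).filter (·.Nonempty) = {S} by
      ext T; simp; constructor
      · rintro ⟨rfl | rfl, h⟩
        · rfl
        · simp at h
      · rintro rfl; exact ⟨.inl rfl, h.nonempty _ hS⟩, Finset.sum_singleton]
    exact single S rfl (.inl e3) (by simp [e2])
  have hne : S ∩ X ≠ S \ X := by
    intro e
    rw [← e, disjoint_self] at hdisj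
    simp [hdisj] at e1
  rw [Finset.filter_true_of_mem (by
    intro T hT
    rcases Finset.mem_insert.1 hT with rfl | hT
    · exact e1
    · rw [Finset.mem_singleton.1 hT]; exact e2), Finset.sum_pair hne]
  by_cases hW : (S, a) ∈ W
  · refine (add_le_add (mono' _ _) (mono' _ _)).trans ?_
    simpa [hW, hunion] using hg.both _ _ a e1 e2 hdisj
  · rcases smaller_eq_or (S ∩ X) (S \ X) with ⟨e, hc⟩ | ⟨e, hc⟩
    · have : (S \ X, a) ∉ splitPending P W X := fun hm =>
        hne (e.symm.trans (pend _ e2 (.inr rfl) hm hW).2.2)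
      refine (add_le_add_left (mono' _ _) _).trans ?_
      simpa [hW, this, hunion] using hg.smaller _ _ a e1 e2 hdisj hc
    · have : (S ∩ X, a) ∉ splitPending P W X := fun hm =>
        hne ((pend _ e1 (.inl rfl) hm hW).2.2.symm.trans e)
      refine (add_le_add_right (mono' _ _) _).trans ?_
      have := hg.smaller _ _ a e2 e1 hdisj.symm hc
      rw [Finset.union_comm, hunion, add_comm] at this
      simp [*]

theorem IsCharge.potential_split_le {g : Finset σ → α → Bool → ℕ} (hg : IsCharge g)
    {P : Finset (Finset σ)} {W : Finset (Finset σ × α)} (h : IsPartition P W) (X : Finset σ) :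
    potential g (splitBlocks P X) (splitPending P W X) ≤ potential g P W := by
  unfold potential
  rw [Finset.sum_product_right, Finset.sum_product_right]
  refine Finset.sum_le_sum fun a _ => ?_
  have n1 : ∅ ∉ P := fun h' => by simpa using h.nonempty _ h'
  have n2 : ∅ ∉ splitBlocks P X := fun h' => by simpa using (mem_splitBlocks.1 h').1
  rw [Finset.sum_insert n1, Finset.sum_insert n2]
  refine add_le_add ?_ ?_
  -- The empty splitter can be pending only at the start; any split discards it.
  · have : ((∅ : Finset σ), a) ∉ splitPending P W X := by
      intro hm
      rcases mem_splitPending.1 hm with ⟨h', -⟩ | ⟨S, hS, -, h1, h2, h3⟩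
      · simp at h'
      · rcases smaller_eq_or (S ∩ X) (S \ X) with ⟨e, -⟩ | ⟨e, -⟩
        · simp [e.symm.trans h3] at h1
        · simp [e.symm.trans h3] at h2
    simp only [this, decide_false]
    cases decide ((∅, a) ∈ W)
    · exact le_rfl
    · exact hg.mono _ _
  -- Grouping the new blocks by their parents reduces the claim to `parts_le`.
  · have hb : splitBlocks P X =
        P.biUnion fun S => ({S ∩ X, S \ X} : Finset (Finset σ)).filter (·.Nonempty) := by
      ext T
      simp only [mem_splitBlocks, Finset.mem_biUnion, Finset.mem_filter, Finset.mem_insert,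
        Finset.mem_singleton]
      constructor
      · rintro ⟨hT, S, hS, h'⟩
        exact ⟨S, hS, by rcases h' with h' | h' <;> simp [h'], hT⟩
      · rintro ⟨S, hS, h', hT⟩
        exact ⟨hT, S, hS, by rcases h' with h' | h' <;> simp [h']⟩
    rw [hb, Finset.sum_biUnion]
    · exact Finset.sum_le_sum fun S hS => hg.parts_le h X a hS
    · intro S hS S' hS' hne
      rw [Function.onFun, Finset.disjoint_left]
      intro T hT hT'
      simp only [Finset.mem_filter, Finset.mem_insert, Finset.mem_singleton] at hT hT'
      obtain ⟨x, hx⟩ := hT.2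
      refine hne (h.eq_of_mem S hS S' hS' x ?_ ?_)
      · rcases hT.1 with rfl | rfl <;> simp_all
      · rcases hT'.1 with rfl | rfl <;> simp_all

theorem potential_erase (g : Finset σ → α → Bool → ℕ) {P : Finset (Finset σ)}
    {W : Finset (Finset σ × α)} (h : IsPartition P W) {p : Finset σ × α} (hp : p ∈ W) {d : ℕ}
    (hd : g p.1 p.2 false + d ≤ g p.1 p.2 true) :
    potential g P (W.erase p) + d ≤ potential g P W := by
  have hmem : p ∈ insert ∅ P ×ˢ (Finset.univ : Finset α) := by
    simp only [Finset.mem_product, Finset.mem_insert, Finset.mem_univ, and_true]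
    exact (h.pending p.1 p.2 hp).symm
  unfold potential
  rw [← Finset.add_sum_erase _ _ hmem, ← Finset.add_sum_erase _ _ hmem]
  have e : ∑ x ∈ (insert ∅ P ×ˢ (Finset.univ : Finset α)).erase p,
      g x.1 x.2 (decide (x ∈ W.erase p)) =
      ∑ x ∈ (insert ∅ P ×ˢ (Finset.univ : Finset α)).erase p, g x.1 x.2 (decide (x ∈ W)) := by
    refine Finset.sum_congr rfl fun x hx => ?_
    simp [Finset.mem_erase, Finset.ne_of_mem_erase hx]
  rw [e]
  simp only [Finset.notMem_erase, hp, decide_false, decide_true]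
  omega

/-- A round is a removal from the pending set, which releases `d`, followed by a split, which
releases at least `0`. -/
theorem IsCharge.potential_round {g : Finset σ → α → Bool → ℕ} (hg : IsCharge g)
    {P : Finset (Finset σ)} {W : Finset (Finset σ × α)} (h : IsPartition P W) (X : Finset σ)
    {p : Finset σ × α} (hp : p ∈ W) {d : ℕ} (hd : g p.1 p.2 false + d ≤ g p.1 p.2 true) :
    potential g (splitBlocks P X) (splitPending P (W.erase p) X) + d ≤ potential g P W :=
  (Nat.add_le_add_right
    (hg.potential_split_le (h.mono (Finset.erase_subset _ _)) X) d).trans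
    (potential_erase g h hp hd)

/-- The charge that counts the remaining rounds. -/
def roundCharge (S : Finset σ) (_ : α) (b : Bool) : ℕ := (S.card - 1) + b.toNat

theorem isCharge_roundCharge : IsCharge (roundCharge : Finset σ → α → Bool → ℕ) where
  mono A a := by simp [roundCharge]
  both A B a hA hB hd := by
    have := Finset.card_pos.2 hA
    have := Finset.card_pos.2 hB
    simp only [roundCharge, Finset.card_union_of_disjoint hd, Bool.toNat_true]
    omega
  smaller A B a hA hB hd _ := by
    have := Finset.card_pos.2 hA
    have := Finset.card_pos.2 hB
    simp only [roundCharge, Finset.card_union_of_disjoint hd, Bool.toNat_true, Bool.toNat_false]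
    omega

/-- The charge that counts the transitions that are still to be traversed. -/
noncomputable def traversalCharge (M : DFA α σ) (S : Finset σ) (a : α) (b : Bool) : ℕ :=
  (sources M S a).card * (Nat.log 2 S.card + b.toNat)

theorem card_sources_union (M : DFA α σ) {A B : Finset σ} (a : α) (h : Disjoint A B) :
    (sources M (A ∪ B) a).card = (sources M A a).card + (sources M B a).card := by
  rw [← Finset.card_union_of_disjoint]
  · congr 1
    ext q
    simp [mem_sources]
  · rw [Finset.disjoint_left]
    intro q hA hB
    exact Finset.disjoint_left.1 h (mem_sources.1 hA) (mem_sources.1 hB)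

/-- The "smaller half" principle: a newly pending part has at most half the size of its parent, so
its logarithm drops by one and pays for the pending mark. -/
theorem isCharge_traversalCharge (M : DFA α σ) : IsCharge (traversalCharge M) where
  mono A a := by unfold traversalCharge; gcongr; simp
  both A B a _ _ hd := by
    have h1 : Nat.log 2 A.card ≤ Nat.log 2 (A ∪ B).card :=
      Nat.log_mono_right (Finset.card_le_card Finset.subset_union_left)
    have h2 : Nat.log 2 B.card ≤ Nat.log 2 (A ∪ B).card :=
      Nat.log_mono_right (Finset.card_le_card Finset.subset_union_right)
    simp only [traversalCharge, card_sources_union M a hd, add_mul]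
    gcongr
  smaller A B a hA _ hd hc := by
    have h1 : Nat.log 2 A.card + 1 ≤ Nat.log 2 (A ∪ B).card := by
      rw [← Nat.log_mul_base one_lt_two (Finset.card_pos.2 hA).ne']
      refine Nat.log_mono_right ?_
      rw [Finset.card_union_of_disjoint hd]
      omega
    have h2 : Nat.log 2 B.card ≤ Nat.log 2 (A ∪ B).card :=
      Nat.log_mono_right (Finset.card_le_card Finset.subset_union_right)
    simp only [traversalCharge, card_sources_union M a hd, add_mul, Bool.toNat_true,
      Bool.toNat_false]
    simp only [add_zero]
    gcongr

/-- Here `h1` covers the case in which all states agree on acceptance: then the pending splitter is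
empty and the only block is the whole state set. -/
theorem potential_init_le (M : DFA α σ) (g : Finset σ → α → Bool → ℕ) (K : ℕ)
    (h0 : ∀ A B a, (∀ q, q ∈ A ↔ q ∉ B) → B.Nonempty → A.Nonempty →
      g ∅ a false + (g A a true + g B a false) ≤ K)
    (h1 : ∀ a, g ∅ a true + g Finset.univ a false ≤ K) :
    potential g (hopcroftInit M).blocks (hopcroftInit M).pending ≤ Fintype.card α * K := by
  obtain ⟨A, B, hAB, hB, -, hP, hW, -⟩ := hopcroftInit_eq M
  unfold potential
  rw [Finset.sum_product_right, ← Finset.card_univ, ← smul_eq_mul]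
  refine Finset.sum_le_card_nsmul _ _ _ fun a _ => ?_
  simp only [hW]
  have hBA : ¬ B = A := by
    rintro rfl
    obtain ⟨x, hx⟩ := hB
    exact (hAB x).1 hx hx
  rcases A.eq_empty_or_nonempty with rfl | hA
  · have : insert ∅ (hopcroftInit M).blocks = {∅, B} := by
      ext S
      simp only [Finset.mem_insert, hP, Finset.mem_singleton]
      constructor
      · tauto
      · rintro (h | rfl)
        · exact .inl h
        · exact .inr ⟨hB, .inr rfl⟩
    have hu : B = Finset.univ := by
      ext x
      simpa using hAB x
    rw [this, Finset.sum_pair (Ne.symm hBA)]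
    simpa [hBA, ← hu] using h1 a
  · have : insert ∅ (hopcroftInit M).blocks = {∅, A, B} := by
      ext S
      simp only [Finset.mem_insert, hP, Finset.mem_singleton]
      constructor
      · tauto
      · rintro (h | rfl | rfl)
        · exact .inl h
        · exact .inr ⟨hA, .inl rfl⟩
        · exact .inr ⟨hB, .inr rfl⟩
    rw [this, Finset.sum_insert, Finset.sum_pair (Ne.symm hBA)]
    · simpa [hBA, hA.ne_empty.symm] using h0 A B a hAB hB hA
    · simp [hA.ne_empty.symm, hB.ne_empty.symm]

theorem card_add_card_of_compl {A B : Finset σ} (h : ∀ q, q ∈ A ↔ q ∉ B) :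
    A.card + B.card = Fintype.card σ := by
  have : A = Bᶜ := by ext q; simp [h]
  rw [this, Finset.card_compl_add_card]

theorem potential_roundCharge_init_le (M : DFA α σ) :
    potential roundCharge (hopcroftInit M).blocks (hopcroftInit M).pending ≤
      Fintype.card α * Fintype.card σ := by
  have : 0 < Fintype.card σ := Fintype.card_pos_iff.2 ⟨M.start⟩
  refine potential_init_le M _ _ ?_ ?_
  · intro A B a h hB hA
    have := card_add_card_of_compl h
    have := Finset.card_pos.2 hA
    have := Finset.card_pos.2 hB
    simp [roundCharge]
    omega
  · intro a
    simp [roundCharge]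
    omega

theorem potential_traversalCharge_init_le (M : DFA α σ) :
    potential (traversalCharge M) (hopcroftInit M).blocks (hopcroftInit M).pending ≤
      Fintype.card α * (Fintype.card σ * (Nat.log 2 (Fintype.card σ) + 1)) := by
  have hs : ∀ a, (sources M ∅ a).card = 0 := by simp [sources]
  refine potential_init_le M _ _ ?_ ?_
  · intro A B a h hB hA
    have hd : Disjoint A B := Finset.disjoint_left.2 fun q hq => (h q).1 hq
    have hsum := card_sources_union M a hd
    have h1 : Nat.log 2 A.card ≤ Nat.log 2 (Fintype.card σ) :=
      Nat.log_mono_right (Finset.card_le_univ _)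
    have h2 : Nat.log 2 B.card ≤ Nat.log 2 (Fintype.card σ) :=
      Nat.log_mono_right (Finset.card_le_univ _)
    simp only [traversalCharge, hs, zero_mul, zero_add, Bool.toNat_true, Bool.toNat_false]
    calc (sources M A a).card * (Nat.log 2 A.card + 1) + (sources M B a).card * (Nat.log 2 B.card + 0)
        ≤ (sources M A a).card * (Nat.log 2 (Fintype.card σ) + 1) +
          (sources M B a).card * (Nat.log 2 (Fintype.card σ) + 1) := by gcongr; omega
      _ = (sources M (A ∪ B) a).card * (Nat.log 2 (Fintype.card σ) + 1) := by rw [hsum, add_mul]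
      _ ≤ _ := by gcongr; exact Finset.card_le_univ _
  · intro a
    simp only [traversalCharge, hs, zero_mul, zero_add, Bool.toNat_false, add_zero]
    refine Nat.mul_le_mul (Finset.card_le_univ _) ?_
    rw [Finset.card_univ]
    omega

theorem roundCharge_drop (p : Finset σ × α) :
    roundCharge p.1 p.2 false + 1 ≤ roundCharge p.1 p.2 true := by
  simp [roundCharge]

/-- Each effective round lowers the round potential by one, and initially it is at most the number
of iterations. If all rounds were effective it is now `0`, whereas a pending splitter would
contribute at least `1`. -/
theorem hopcroft_pending (M : DFA α σ) : (hopcroft M).pending = ∅ := by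
  have key : ∀ n, let s := (hopcroftRound M)^[n] (hopcroftInit M)
      s.pending = ∅ ∨
        potential roundCharge s.blocks s.pending + n ≤ Fintype.card α * Fintype.card σ := by
    intro n
    induction n with
    | zero => exact .inr (potential_roundCharge_init_le M)
    | succ n ih =>
      have hinv := hopcroftInv_iterate M n
      simp only [Function.iterate_succ_apply']
      generalize (hopcroftRound M)^[n] (hopcroftInit M) = s at ih hinv ⊢
      rcases s.pending.eq_empty_or_nonempty with e | e
      · rw [hopcroftRound_of_empty M s e]
        exact .inl e
      · right
        have ih' := ih.resolve_left e.ne_empty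
        obtain ⟨p, hp, hr⟩ := hopcroftRound_of_nonempty M s e
        rw [hr]
        have := isCharge_roundCharge.potential_round hinv.toIsPartition (sources M p.1 p.2) hp
          (roundCharge_drop p)
        simp only
        omega
  have h := key (Fintype.card α * Fintype.card σ)
  have hinv := hopcroftInv_iterate M (Fintype.card α * Fintype.card σ)
  change (hopcroft M).pending = ∅ ∨ potential roundCharge (hopcroft M).blocks
    (hopcroft M).pending + _ ≤ _ at h
  change HopcroftInv M (hopcroft M).blocks (hopcroft M).pending at hinv
  rcases (hopcroft M).pending.eq_empty_or_nonempty with e | ⟨p, hp⟩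
  · exact e
  · refine h.resolve_right fun h' => ?_
    have := potential_erase roundCharge hinv.toIsPartition hp (roundCharge_drop p)
    omega

/-- The sum of the time and both potentials never increases: the `1` of a round is paid by
`roundCharge`, the traversed transitions by `traversalCharge`. -/
theorem hopcroft_time_le (M : DFA α σ) : (hopcroft M).time ≤
    Fintype.card α * (Fintype.card σ * (Nat.log 2 (Fintype.card σ) + 2)) := by
  have key : ∀ n, let s := (hopcroftRound M)^[n] (hopcroftInit M)
      s.time + potential roundCharge s.blocks s.pending +
        potential (traversalCharge M) s.blocks s.pending ≤
      Fintype.card α * (Fintype.card σ * (Nat.log 2 (Fintype.card σ) + 2)) := by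
    intro n
    induction n with
    | zero =>
      have h1 := potential_roundCharge_init_le M
      have h2 := potential_traversalCharge_init_le M
      have h3 : (hopcroftInit M).time = 0 := rfl
      simp only [Function.iterate_zero, id_eq, h3]
      linarith
    | succ n ih =>
      have hinv := hopcroftInv_iterate M n
      simp only [Function.iterate_succ_apply']
      generalize (hopcroftRound M)^[n] (hopcroftInit M) = s at ih hinv ⊢
      rcases s.pending.eq_empty_or_nonempty with e | e
      · rw [hopcroftRound_of_empty M s e]
        exact ih
      · obtain ⟨p, hp, hr⟩ := hopcroftRound_of_nonempty M s e
        rw [hr]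
        have h1 := isCharge_roundCharge.potential_round hinv.toIsPartition (sources M p.1 p.2) hp
          (roundCharge_drop p)
        have h2 := (isCharge_traversalCharge M).potential_round hinv.toIsPartition
          (sources M p.1 p.2) hp (d := (sources M p.1 p.2).card)
          (by simp only [traversalCharge, Bool.toNat_false, Bool.toNat_true]; linarith)
        simp only at ih ⊢
        omega
  have h := key (Fintype.card α * Fintype.card σ)
  change (hopcroft M).time + _ + _ ≤ _ at h
  omega

/-- At the end, two states lie in the same blocks if and only if they are equivalent. -/
theorem sameBlocks_hopcroft (M : DFA α σ) (p q : σ) :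
    SameBlocks (hopcroft M).blocks p q ↔ M.acceptsFrom p = M.acceptsFrom q := by
  have hinv : HopcroftInv M (hopcroft M).blocks (hopcroft M).pending := hopcroftInv_iterate M _
  -- With nothing pending, `stable` makes `SameBlocks` a congruence for the transitions; since it
  -- respects acceptance, it implies equivalence.
  rw [hopcroft_pending] at hinv
  refine ⟨fun h => ?_, hinv.sameBlocks_of_equiv p q⟩
  ext w
  rw [DFA.mem_acceptsFrom, DFA.mem_acceptsFrom]
  induction w generalizing p q with
  | nil => exact hinv.accept p q h
  | cons a w ih => exact ih _ _ (hinv.stable a p q h (by simp))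

end Hopcroft
/-! ### Minimization -/

section Collapse

set_option linter.unusedSectionVars false

variable {α σ : Type} [Fintype α] [Fintype σ]

theorem accessible_evalFrom (M : DFA α σ) (q : Reach M) (w : List α) :
    ((accessible M).evalFrom q w).1 = M.evalFrom q.1 w := by
  induction w generalizing q with
  | nil => rfl
  | cons a w ih => exact ih _

theorem accessible_acceptsFrom (M : DFA α σ) (q : Reach M) :
    (accessible M).acceptsFrom q = M.acceptsFrom q.1 := by
  ext w
  rw [DFA.mem_acceptsFrom, DFA.mem_acceptsFrom, ← accessible_evalFrom]
  rfl

theorem accessible_eval_surjective (M : DFA α σ) (q : Reach M) :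
    ∃ w, (accessible M).eval w = q := by
  obtain ⟨w, hw⟩ := q.2
  exact ⟨w, Subtype.ext ((accessible_evalFrom M _ w).trans hw)⟩

/-- The arbitrary choice of representatives is harmless because members of a block accept the same
words. -/
theorem collapse_acceptsFrom {M : DFA α σ} {P : Finset (Finset σ)}
    (h : ∀ p q, SameBlocks P p q → M.acceptsFrom p = M.acceptsFrom q) (q : σ) :
    (collapse M P).acceptsFrom (Quotient.mk _ q) = M.acceptsFrom q := by
  have hout : ∀ q : σ,
      M.acceptsFrom (Quotient.mk (blockSetoid P) q).out = M.acceptsFrom q :=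
    fun q => h _ _ (Quotient.mk_out (s := blockSetoid P) q)
  ext w
  induction w generalizing q with
  | nil =>
    rw [← hout q]
    rfl
  | cons a w ih =>
    rw [DFA.mem_acceptsFrom, DFA.evalFrom_cons, ← DFA.mem_acceptsFrom]
    refine (ih _).trans ?_
    rw [acceptsFrom_step_eq (hout q) a]
    rfl

theorem collapse_eval_surjective {M : DFA α σ} {P : Finset (Finset σ)}
    (h : ∀ p q, SameBlocks P p q ↔ M.acceptsFrom p = M.acceptsFrom q)
    (hM : ∀ q, ∃ w, M.eval w = q) (b : Quotient (blockSetoid P)) :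
    ∃ w, (collapse M P).eval w = b := by
  have key : ∀ w, (collapse M P).eval w = Quotient.mk _ (M.eval w) := by
    intro w
    induction w using List.reverseRecOn with
    | nil => rfl
    | append_singleton w a ih =>
      rw [DFA.eval_append_singleton, DFA.eval_append_singleton, ih]
      refine Quotient.sound ?_
      change SameBlocks P _ _
      rw [h]
      refine acceptsFrom_step_eq ?_ a
      rw [← h]
      exact Quotient.mk_out (s := blockSetoid P) _
  obtain ⟨q, rfl⟩ := Quotient.exists_rep b
  obtain ⟨w, rfl⟩ := hM q
  exact ⟨w, key w⟩

end Collapse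

/-- All states are accessible and no two are equivalent. -/
structure Auto.IsMinimal {k : ℕ} (A : Auto k) : Prop where
  reachable : ∀ q, ∃ w, A.dfa.eval w = q
  reduced : ∀ p q, A.dfa.acceptsFrom p = A.dfa.acceptsFrom q → p = q

theorem card_letters (k : ℕ) : Fintype.card (Fin k → Bool) = 2 ^ k := by simp

section Minimize

variable {k : ℕ} (A : Auto k)

theorem minimize_acceptsFrom (q : Reach A.dfa) :
    (minimize A).aut.dfa.acceptsFrom (Quotient.mk _ q) = A.dfa.acceptsFrom q.1 :=
  (collapse_acceptsFrom (fun p q => (sameBlocks_hopcroft (accessible A.dfa) p q).1) q).trans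
    (accessible_acceptsFrom A.dfa q)

theorem minimize_accepts : (minimize A).aut.dfa.accepts = A.dfa.accepts :=
  minimize_acceptsFrom A ⟨A.dfa.start, [], rfl⟩

theorem minimize_isMinimal : (minimize A).aut.IsMinimal where
  reachable := collapse_eval_surjective (sameBlocks_hopcroft (accessible A.dfa))
    (accessible_eval_surjective A.dfa)
  reduced p q h := by
    obtain ⟨p, rfl⟩ := Quotient.exists_rep p
    obtain ⟨q, rfl⟩ := Quotient.exists_rep q
    refine Quotient.sound ((sameBlocks_hopcroft (accessible A.dfa) p q).2 ?_)
    rw [accessible_acceptsFrom, accessible_acceptsFrom, ← minimize_acceptsFrom,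
      ← minimize_acceptsFrom]
    exact h

theorem card_reach_le : Fintype.card (Reach A.dfa) ≤ Fintype.card A.State :=
  Fintype.card_le_of_injective _ Subtype.val_injective

theorem card_minimize_le_reach :
    Fintype.card (minimize A).aut.State ≤ Fintype.card (Reach A.dfa) :=
  Fintype.card_le_of_surjective _ Quotient.mk_surjective

theorem card_minimize_le : Fintype.card (minimize A).aut.State ≤ Fintype.card A.State :=
  (card_minimize_le_reach A).trans (card_reach_le A)

theorem minimize_time_le : (minimize A).time ≤
    2 ^ k * (Fintype.card A.State * (Nat.log 2 (Fintype.card A.State) + 5)) := by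
  have h1 := hopcroft_time_le (accessible A.dfa)
  have h2 := card_reach_le A
  have h3 : Fintype.card (Quotient (blockSetoid (hopcroft (accessible A.dfa)).blocks)) ≤
    Fintype.card (Reach A.dfa) := card_minimize_le_reach A
  have h4 : Nat.log 2 (Fintype.card (Reach A.dfa)) ≤ Nat.log 2 (Fintype.card A.State) :=
    Nat.log_mono_right h2
  rw [card_letters] at h1
  change _ + _ + _ + _ ≤ _
  calc _ ≤ Fintype.card A.State * 2 ^ k + Fintype.card A.State * 2 ^ k +
        2 ^ k * (Fintype.card A.State * (Nat.log 2 (Fintype.card A.State) + 2)) +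
        Fintype.card A.State * 2 ^ k := by
        refine add_le_add (add_le_add (add_le_add le_rfl ?_) (h1.trans ?_)) ?_
        · gcongr
        · gcongr
        · gcongr; exact h3.trans h2
    _ = _ := by ring

end Minimize

/-- Myhill–Nerode: a word reaching each state of `A` is run in `M`; if two of these runs met, the
two states would accept the same words. -/
theorem Auto.IsMinimal.card_le {k : ℕ} {A : Auto k} (h : A.IsMinimal) {σ : Type} [Fintype σ]
    {M : DFA (Fin k → Bool) σ} (hM : M.accepts = A.dfa.accepts) :
    Fintype.card A.State ≤ Fintype.card σ := by
  choose w hw using h.reachable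
  refine Fintype.card_le_of_injective (fun q => M.eval (w q)) fun p q hpq => h.reduced p q ?_
  have key : ∀ q, A.dfa.acceptsFrom q = M.acceptsFrom (M.eval (w q)) := by
    intro q
    ext v
    have : w q ++ v ∈ M.accepts ↔ w q ++ v ∈ A.dfa.accepts := by rw [hM]
    rw [DFA.mem_acceptsFrom, DFA.mem_acceptsFrom]
    rw [DFA.mem_accepts, DFA.mem_accepts, DFA.eval, DFA.eval, DFA.evalFrom_of_append,
      DFA.evalFrom_of_append] at this
    have e : A.dfa.evalFrom A.dfa.start (w q) = q := hw q
    rw [e] at this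
    exact this.symm
  rw [key p, key q]
  exact congrArg _ hpq

/-! ### Conjunction and projection -/

theorem mem_product_accepts {i j k : ℕ} (f : Fin i → Fin k) (A : Auto i) (g : Fin j → Fin k)
    (B : Auto j) (w : List (Fin k → Bool)) :
    w ∈ (product f A g B).dfa.accepts ↔
      w.map (· ∘ f) ∈ A.dfa.accepts ∧ w.map (· ∘ g) ∈ B.dfa.accepts := by
  change w ∈ ((A.dfa.comap fun a => a ∘ f).inter (B.dfa.comap fun a => a ∘ g)).accepts ↔ _
  rw [DFA.accepts_inter, Language.mem_inf, DFA.mem_accepts, DFA.mem_accepts, DFA.eval_comap,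
    DFA.eval_comap]
  rfl

/-- The letter `0` on all tracks. -/
def zeroLetter (k : ℕ) : Fin k → Bool := fun _ => false

/-- The `m` leading zero letters come from the enlarged set of start states: they give the removed
track room to be longer than `x`. -/
theorem mem_project_eval {k : ℕ} (A : Auto (k + 1)) (x : List (Fin k → Bool)) (q : A.State) :
    q ∈ (project A).eval x ↔ ∃ (m : ℕ) (W : List (Fin (k + 1) → Bool)),
      W.map Fin.tail = List.replicate m (zeroLetter k) ++ x ∧ A.dfa.eval W = q := by
  induction x using List.reverseRecOn generalizing q with
  | nil =>
    rw [NFA.eval_nil]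
    constructor
    · rintro ⟨u, rfl⟩
      refine ⟨u.length, _, ?_, rfl⟩
      rw [List.map_map, List.append_nil, List.eq_replicate_iff]
      simp only [List.length_map, List.mem_map, true_and]
      rintro _ ⟨b, -, rfl⟩
      rfl
    · rintro ⟨m, W, hW, rfl⟩
      refine ⟨W.map (· 0), ?_⟩
      congr 1
      rw [List.map_map]
      conv_rhs => rw [← List.map_id W]
      refine List.map_congr_left fun a ha => ?_
      have : Fin.tail a ∈ W.map Fin.tail := List.mem_map_of_mem ha
      rw [hW, List.append_nil] at this
      have h0 : Fin.tail a = zeroLetter k := List.eq_of_mem_replicate this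
      change Fin.cons (a 0) (zeroLetter k) = a
      rw [← h0, Fin.cons_self_tail]
  | append_singleton x a ih =>
    rw [NFA.eval_append_singleton, NFA.mem_stepSet]
    constructor
    · rintro ⟨r, hr, b, hb⟩
      obtain ⟨m, W, hW, rfl⟩ := (ih r).1 hr
      exact ⟨m, W ++ [Fin.cons b a], by simp [hW], by rw [DFA.eval_append_singleton, hb]⟩
    · rintro ⟨m, W, hW, rfl⟩
      rw [← List.append_assoc] at hW
      obtain ⟨W', l, rfl, h1, h2⟩ := List.map_eq_append_iff.1 hW
      obtain ⟨c, rfl, rfl⟩ := List.map_eq_singleton_iff.1 h2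
      refine ⟨A.dfa.eval W', (ih _).2 ⟨m, W', h1, rfl⟩, c 0, ?_⟩
      rw [Fin.cons_self_tail, DFA.eval_append_singleton]

theorem mem_determinize_accepts {k : ℕ} (A : Auto (k + 1)) (x : List (Fin k → Bool)) :
    x ∈ (determinize A).dfa.accepts ↔ ∃ (m : ℕ) (W : List (Fin (k + 1) → Bool)),
      W.map Fin.tail = List.replicate m (zeroLetter k) ++ x ∧ W ∈ A.dfa.accepts := by
  have h1 : (determinize A).dfa.accepts = (project A).toDFA.accepts :=
    accessible_acceptsFrom (project A).toDFA ⟨(project A).toDFA.start, [], rfl⟩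
  rw [h1, NFA.toDFA_correct, NFA.mem_accepts]
  change (∃ q ∈ A.dfa.accept, q ∈ (project A).eval x) ↔ _
  simp only [mem_project_eval A x]
  constructor
  · rintro ⟨q, hq, m, W, hW, rfl⟩
    exact ⟨m, W, hW, hq⟩
  · rintro ⟨m, W, hW, hq⟩
    exact ⟨_, hq, m, W, hW, rfl⟩

/-! ### Tracks and linear forms -/

section Tracks

variable {k : ℕ}

theorem track_append (i : Fin k) (w v : List (Fin k → Bool)) :
    track i (w ++ v) = track i w ++ track i v := by simp [track]

theorem track_singleton (i : Fin k) (a : Fin k → Bool) : track i [a] = [a i] := rfl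

theorem track_length (i : Fin k) (w : List (Fin k → Bool)) : (track i w).length = w.length := by
  simp [track]

theorem track_replicate_append (i : Fin k) (m : ℕ) (w : List (Fin k → Bool)) :
    track i (List.replicate m (zeroLetter k) ++ w) = List.replicate m false ++ track i w := by
  simp [track, zeroLetter]

theorem track_succ (i : Fin k) (w : List (Fin (k + 1) → Bool)) :
    track i.succ w = track i (w.map Fin.tail) := by
  simp [track, Fin.tail]

theorem track_map_comp {j : ℕ} (f : Fin j → Fin k) (s : Fin j) (w : List (Fin k → Bool)) :
    track s (w.map (· ∘ f)) = track (f s) w := by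
  simp [track]

theorem exists_word_of_tracks (y : List Bool) (x : List (Fin k → Bool))
    (h : y.length = x.length) :
    ∃ W : List (Fin (k + 1) → Bool), W.map Fin.tail = x ∧ track 0 W = y := by
  induction y generalizing x with
  | nil => exact ⟨[], by simpa using h.symm, rfl⟩
  | cons b y ih =>
    obtain ⟨a, x, rfl⟩ := List.exists_cons_of_length_eq_add_one h.symm
    obtain ⟨W, rfl, rfl⟩ := ih x (by simpa using h)
    exact ⟨Fin.cons b a :: W, by simp [Fin.tail_cons], by simp [track]⟩

/-- All tracks are valid representations. -/
def ValidTracks (w : List (Fin k → Bool)) : Prop := ∀ i, IsFibRep (track i w)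

theorem ValidTracks.of_append {w v : List (Fin k → Bool)} (h : ValidTracks (w ++ v)) :
    ValidTracks w := fun i => by
  have := h i
  rw [track_append, isFibRep_append] at this
  exact this.1

theorem ValidTracks.append_right {w v : List (Fin k → Bool)} (h : ValidTracks (w ++ v)) :
    ValidTracks v := fun i => by
  have := h i
  rw [track_append] at this
  exact List.IsChain.right_of_append this

/-- The integer `∑ βᵢ [xᵢ]` for the tracks `xᵢ` of a word. -/
def lin (β : Fin k → ℤ) (w : List (Fin k → Bool)) : ℤ := ∑ i, β i * fibVal (track i w)

/-- The integer `∑ βᵢ [xᵢ0]` for the tracks `xᵢ` of a word. -/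
def linShift (β : Fin k → ℤ) (w : List (Fin k → Bool)) : ℤ := ∑ i, β i * fibShift (track i w)

theorem lin_append_of_length (β : Fin k → ℤ) (w v : List (Fin k → Bool)) (n : ℕ)
    (h : v.length = n + 1) :
    lin β (w ++ v) = Nat.fib (n + 1) * linShift β w + Nat.fib n * lin β w + lin β v := by
  simp only [lin, linShift, Finset.mul_sum, ← Finset.sum_add_distrib]
  refine Finset.sum_congr rfl fun i _ => ?_
  rw [track_append, fibVal_append_of_length _ _ n (by rw [track_length, h])]
  push_cast
  ring

end Tracks

/-! ### The basic automata -/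

theorem isFibRep_replicate (n : ℕ) : IsFibRep (List.replicate n false) := by
  simpa using (isFibRep_replicate_append n []).2 isFibRep_nil

theorem isFibRep_and_fibVal_eq_zero_iff (x : List Bool) :
    (IsFibRep x ∧ fibVal x = 0) ↔ x = List.replicate x.length false := by
  constructor
  · rintro ⟨h, h0⟩
    exact h.eq_of_length_eq (isFibRep_replicate _) (by simp) (by rw [h0, fibVal_replicate])
  · intro h
    rw [h]
    exact ⟨isFibRep_replicate _, fibVal_replicate _⟩

theorem isFibRep_and_fibVal_eq_one_iff (x : List Bool) :
    (IsFibRep x ∧ fibVal x = 1) ↔ ∃ n, x = List.replicate n false ++ [true] := by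
  constructor
  · rintro ⟨h, h1⟩
    have hx : 0 < x.length := by
      rcases x with _ | ⟨b, x⟩
      · simp [fibVal] at h1
      · simp
    refine ⟨x.length - 1, h.eq_of_length_eq ?_ (by simp; omega) ?_⟩
    · rw [isFibRep_replicate_append]; simp [IsFibRep]
    · rw [fibVal_replicate_append, h1]; rfl
  · rintro ⟨n, rfl⟩
    rw [isFibRep_replicate_append, fibVal_replicate_append]
    exact ⟨by simp [IsFibRep], rfl⟩

theorem mem_zeroAuto_accepts (w : List (Fin 1 → Bool)) :
    w ∈ zeroAuto.dfa.accepts ↔ ValidTracks w ∧ fibVal (track 0 w) = 0 := by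
  have key : ∀ (w : List (Fin 1 → Bool)) (q : Bool), zeroAuto.dfa.evalFrom q w = true ↔
      q = true ∧ track 0 w = List.replicate (track 0 w).length false := by
    intro w
    induction w with
    | nil => intro q; exact ⟨fun h => ⟨h, rfl⟩, fun h => h.1⟩
    | cons a w ih =>
      intro q
      refine (ih _).trans ?_
      simp [track, zeroAuto, List.replicate_succ, and_assoc]
  rw [ValidTracks, Fin.forall_fin_one, isFibRep_and_fibVal_eq_zero_iff, DFA.mem_accepts]
  refine (key w true).trans ?_
  simp

theorem mem_oneAuto_accepts (w : List (Fin 1 → Bool)) :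
    w ∈ oneAuto.dfa.accepts ↔ ValidTracks w ∧ fibVal (track 0 w) = 1 := by
  have key : ∀ w : List (Fin 1 → Bool),
      (oneAuto.dfa.eval w = (0 : Fin 3) ↔ track 0 w = List.replicate (track 0 w).length false) ∧
      (oneAuto.dfa.eval w = (1 : Fin 3) ↔ ∃ n, track 0 w = List.replicate n false ++ [true]) := by
    intro w
    induction w using List.reverseRecOn with
    | nil =>
      refine ⟨by simp [track, oneAuto], ?_⟩
      simp [track, oneAuto]
    | append_singleton w a ih =>
      obtain ⟨q, hq⟩ : ∃ q : Fin 3, oneAuto.dfa.eval w = q := ⟨_, rfl⟩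
      have hstep : oneAuto.dfa.eval (w ++ [a]) =
          (if q = 0 then (if a 0 then 1 else 0) else 2 : Fin 3) :=
        (DFA.eval_append_singleton ..).trans (by rw [hq]; rfl)
      have ih := ih.1
      rw [hq] at ih
      change q = 0 ↔ _ at ih
      rw [hstep, track_append, track_singleton]
      change ((if q = 0 then (if a 0 then 1 else 0) else 2 : Fin 3) = 0 ↔ _) ∧
        ((if q = 0 then (if a 0 then 1 else 0) else 2 : Fin 3) = 1 ↔ _)
      generalize track 0 w = x at ih ⊢
      have h1 : (∃ n, x ++ [a 0] = List.replicate n false ++ [true]) ↔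
          x = List.replicate x.length false ∧ a 0 = true := by
        constructor
        · rintro ⟨n, hn⟩
          obtain ⟨rfl, h⟩ := List.append_inj' hn rfl
          simpa using h
        · rintro ⟨h, ha⟩
          exact ⟨x.length, by rw [← h, ha]⟩
      have h2 : x ++ [a 0] = List.replicate (x ++ [a 0]).length false ↔
          x = List.replicate x.length false ∧ a 0 = false := by
        rw [List.length_append, List.length_singleton, List.replicate_succ']
        constructor
        · intro h
          obtain ⟨h, h'⟩ := List.append_inj' h rfl
          exact ⟨h, by simpa using h'⟩
        · rintro ⟨h, h'⟩
          rw [← h, h']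
      rw [h1, h2, ← ih]
      by_cases h : q = 0 <;> cases a 0 <;> simp [h]
  rw [ValidTracks, Fin.forall_fin_one, isFibRep_and_fibVal_eq_one_iff, DFA.mem_accepts]
  exact (key w).2

/-! ### The adder -/

/-- The coefficients of `[x] + [y] - [z]`. -/
def addCoeff : Fin 3 → ℤ := ![1, 1, -1]

theorem lin_addCoeff (w : List (Fin 3 → Bool)) : lin addCoeff w =
    fibVal (track 0 w) + fibVal (track 1 w) - fibVal (track 2 w) := by
  simp [lin, addCoeff, Fin.sum_univ_three]; ring

theorem linShift_addCoeff (w : List (Fin 3 → Bool)) : linShift addCoeff w =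
    fibShift (track 0 w) + fibShift (track 1 w) - fibShift (track 2 w) := by
  simp [linShift, addCoeff, Fin.sum_univ_three]; ring

/-- This justifies the dead state of the adder. Put `u = [x] + [y] - [z]` and `e` for its shift
minus `gu`. With `|v| = n + 1`, `A = F_{n+1}` and `B = F_n`, the equation reads `(Ag + B)u + Ae + d
= 0`, where `d` is the contribution of `v`. Since `e` is bounded and each track of `v` is worth at
most `2A + B`, `u` is bounded, and so is its shift. -/
theorem lin_addCoeff_mem_Icc {w v : List (Fin 3 → Bool)} (h : ValidTracks (w ++ v))
    (h0 : lin addCoeff (w ++ v) = 0) :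
    lin addCoeff w ∈ Finset.Icc (-7 : ℤ) 7 ∧ linShift addCoeff w ∈ Finset.Icc (-7 : ℤ) 7 := by
  obtain ⟨g1, g2⟩ := goldenRatio_bounds
  have hg := Real.goldenRatio_sq
  set g := Real.goldenRatio
  have hb : ∀ i, g - 2 ≤ fibShift (track i w) - g * fibVal (track i w) ∧
      fibShift (track i w) - g * fibVal (track i w) ≤ g - 1 := fun i => by
    have := (h.of_append i).fibShift_sub_bounds hg g1 (by linarith)
    refine ⟨this.1, this.2.trans ?_⟩
    split_ifs <;> linarith
  -- The three errors lie in `[g - 2, g - 1]`, so the combination lies in `[g - 3, g]`.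
  have hv : (linShift addCoeff w : ℝ) - g * lin addCoeff w ≤ 1.62 ∧
      -1.4 ≤ (linShift addCoeff w : ℝ) - g * lin addCoeff w := by
    have e : (linShift addCoeff w : ℝ) - g * lin addCoeff w =
        (fibShift (track 0 w) - g * fibVal (track 0 w)) +
        (fibShift (track 1 w) - g * fibVal (track 1 w)) -
        (fibShift (track 2 w) - g * fibVal (track 2 w)) := by
      rw [lin_addCoeff, linShift_addCoeff]; push_cast; ring
    rw [e]
    have b0 := hb 0
    have b1 := hb 1
    have b2 := hb 2
    constructor <;> linarith [b0.1, b0.2, b1.1, b1.2, b2.1, b2.2]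
  have hu : -3 ≤ lin addCoeff w ∧ lin addCoeff w ≤ 2 := by
    rcases v.length.eq_zero_or_pos with hl | hl
    · rw [List.length_eq_zero_iff.1 hl, List.append_nil] at h0
      rw [h0]; norm_num
    obtain ⟨n, hn⟩ := Nat.exists_eq_add_of_lt hl
    rw [zero_add] at hn
    rw [lin_append_of_length _ _ _ n hn] at h0
    have hlt : ∀ i, (fibVal (track i v) : ℝ) ≤ 2 * Nat.fib (n + 1) + Nat.fib n := fun i => by
      have := (h.append_right i).fibVal_lt
      rw [track_length, hn, show n + 1 + 2 = (n + 1) + 2 by ring, Nat.fib_add_two,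
        Nat.fib_add_two (n := n)] at this
      have : fibVal (track i v) ≤ 2 * Nat.fib (n + 1) + Nat.fib n := by omega
      exact_mod_cast this
    have hA : (1 : ℝ) ≤ Nat.fib (n + 1) := by
      exact_mod_cast Nat.fib_pos.2 (Nat.succ_pos n)
    have hB : (0 : ℝ) ≤ Nat.fib n := Nat.cast_nonneg _
    have h0' : (Nat.fib (n + 1) : ℝ) * linShift addCoeff w + Nat.fib n * lin addCoeff w +
        (fibVal (track 0 v) + fibVal (track 1 v) - fibVal (track 2 v)) = 0 := by
      rw [lin_addCoeff v] at h0
      exact_mod_cast h0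
    have p0 : (0 : ℝ) ≤ fibVal (track 0 v) := Nat.cast_nonneg _
    have p1 : (0 : ℝ) ≤ fibVal (track 1 v) := Nat.cast_nonneg _
    have p2 : (0 : ℝ) ≤ fibVal (track 2 v) := Nat.cast_nonneg _
    have q0 := hlt 0
    have q1 := hlt 1
    have q2 := hlt 2
    generalize (Nat.fib (n + 1) : ℝ) = A at *
    generalize (Nat.fib n : ℝ) = B at *
    constructor
    · by_contra! hc
      have hc' : (lin addCoeff w : ℝ) ≤ -4 := by exact_mod_cast (by omega : lin addCoeff w ≤ -4)
      have m1 := mul_le_mul_of_nonneg_left hc' (by nlinarith : (0 : ℝ) ≤ A * g + B)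
      have m2 := mul_le_mul_of_nonneg_left hv.1 (by linarith : (0 : ℝ) ≤ A)
      nlinarith
    · by_contra! hc
      have hc' : (3 : ℝ) ≤ lin addCoeff w := by exact_mod_cast (by omega : 3 ≤ lin addCoeff w)
      have m1 := mul_le_mul_of_nonneg_left hc' (by nlinarith : (0 : ℝ) ≤ A * g + B)
      have m2 := mul_le_mul_of_nonneg_left hv.2 (by linarith : (0 : ℝ) ≤ A)
      nlinarith
  have u1 : (-3 : ℝ) ≤ lin addCoeff w := by exact_mod_cast hu.1
  have u2 : (lin addCoeff w : ℝ) ≤ 2 := by exact_mod_cast hu.2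
  have v1 : (-7 : ℝ) ≤ linShift addCoeff w := by nlinarith [hv.2]
  have v2 : (linShift addCoeff w : ℝ) ≤ 7 := by nlinarith [hv.1]
  rw [Finset.mem_Icc, Finset.mem_Icc]
  exact ⟨⟨by linarith [hu.1], by linarith [hu.2]⟩, by exact_mod_cast v1, by exact_mod_cast v2⟩

theorem lin_addCoeff_append_singleton (w : List (Fin 3 → Bool)) (a : Fin 3 → Bool) :
    lin addCoeff (w ++ [a]) = linShift addCoeff w +
      ((a 0).toNat + (a 1).toNat - (a 2).toNat) := by
  rw [lin_addCoeff, linShift_addCoeff]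
  simp only [track_append, track_singleton, fibVal_append_singleton]
  push_cast; ring

theorem linShift_addCoeff_append_singleton (w : List (Fin 3 → Bool)) (a : Fin 3 → Bool) :
    linShift addCoeff (w ++ [a]) = lin addCoeff w + linShift addCoeff w +
      2 * ((a 0).toNat + (a 1).toNat - (a 2).toNat) := by
  rw [lin_addCoeff, linShift_addCoeff, linShift_addCoeff]
  simp only [track_append, track_singleton, fibShift_append_singleton]
  push_cast; ring

/-- The state `s` of the adder describes the word `w`. -/
structure AddStateOf (w : List (Fin 3 → Bool)) (s : AddState) : Prop where
  valid : ValidTracks w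
  val : (s.1.1 : ℤ) = lin addCoeff w
  shift : (s.1.2 : ℤ) = linShift addCoeff w
  last : ∀ i, s.2 i = lastBit (track i w)

theorem validTracks_append_singleton {k : ℕ} (w : List (Fin k → Bool)) (a : Fin k → Bool) :
    ValidTracks (w ++ [a]) ↔
      ValidTracks w ∧ ¬ ∃ i, lastBit (track i w) = true ∧ a i = true := by
  simp only [ValidTracks, track_append, track_singleton, isFibRep_append_singleton, forall_and,
    not_exists]

theorem addStep_some_eq_some {r s : AddState} {a : Fin 3 → Bool}
    (h : addStep (some r) a = some s) : (¬ ∃ i, r.2 i = true ∧ a i = true) ∧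
      (s.1.1 : ℤ) = r.1.2 + ((a 0).toNat + (a 1).toNat - (a 2).toNat) ∧
      (s.1.2 : ℤ) = r.1.1 + r.1.2 + 2 * ((a 0).toNat + (a 1).toNat - (a 2).toNat) ∧
      s.2 = a := by
  rw [addStep] at h
  split_ifs at h with h1 h2
  have := (Option.some.inj h).symm
  subst this
  exact ⟨h1, rfl, rfl, rfl⟩

theorem exists_addStep_some_eq_some {r : AddState} {a : Fin 3 → Bool}
    (h1 : ¬ ∃ i, r.2 i = true ∧ a i = true)
    (h2 : (r.1.2 : ℤ) + ((a 0).toNat + (a 1).toNat - (a 2).toNat) ∈ Finset.Icc (-7 : ℤ) 7 ∧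
      (r.1.1 : ℤ) + r.1.2 + 2 * ((a 0).toNat + (a 1).toNat - (a 2).toNat) ∈
        Finset.Icc (-7 : ℤ) 7) :
    ∃ s, addStep (some r) a = some s := by
  rw [addStep, if_neg h1]
  exact ⟨_, dif_pos h2⟩

/-- A live state always describes its word; conversely, a valid word stays alive if none of its
prefixes leaves the range. -/
theorem addAuto_eval_spec (w : List (Fin 3 → Bool)) :
    (∀ s, addAuto.dfa.eval w = some s → AddStateOf w s) ∧
    (ValidTracks w → (∀ p, p <+: w → lin addCoeff p ∈ Finset.Icc (-7 : ℤ) 7 ∧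
      linShift addCoeff p ∈ Finset.Icc (-7 : ℤ) 7) → ∃ s, addAuto.dfa.eval w = some s) := by
  induction w using List.reverseRecOn with
  | nil =>
    constructor
    · intro s hs
      have : s = ((⟨0, by decide⟩, ⟨0, by decide⟩), fun _ => false) :=
        (Option.some.inj hs).symm
      subst this
      refine ⟨fun i => isFibRep_nil, ?_, ?_, fun i => rfl⟩ <;>
      simp [lin, linShift, fibVal, fibShift, track]
    · intro _ _
      exact ⟨_, rfl⟩
  | append_singleton w a ih =>
    have hstep : addAuto.dfa.eval (w ++ [a]) = addStep (addAuto.dfa.eval w) a :=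
      DFA.eval_append_singleton ..
    rw [hstep]
    constructor
    · intro s hs
      cases hq : addAuto.dfa.eval w with
      | none => rw [hq] at hs; simp [addStep] at hs
      | some r =>
        have hr := ih.1 r hq
        rw [hq] at hs
        obtain ⟨h1, h2, h3, h4⟩ := addStep_some_eq_some hs
        refine ⟨?_, ?_, ?_, ?_⟩
        · rw [validTracks_append_singleton]
          refine ⟨hr.valid, ?_⟩
          simpa only [hr.last] using h1
        · rw [lin_addCoeff_append_singleton, ← hr.shift, h2]
        · rw [linShift_addCoeff_append_singleton, ← hr.shift, ← hr.val, h3]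
        · intro i
          rw [track_append, track_singleton, lastBit_append_singleton, h4]
    · intro hv hp
      obtain ⟨r, hq⟩ := ih.2 hv.of_append fun p h => hp p (h.trans (List.prefix_append _ _))
      have hr := ih.1 r hq
      rw [hq]
      refine exists_addStep_some_eq_some ?_ ?_
      · simpa only [hr.last] using ((validTracks_append_singleton w a).1 hv).2
      · have := hp _ (List.prefix_refl _)
        rwa [lin_addCoeff_append_singleton, linShift_addCoeff_append_singleton, ← hr.shift,
          ← hr.val] at this

theorem mem_addAuto_accepts (w : List (Fin 3 → Bool)) : w ∈ addAuto.dfa.accepts ↔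
    ValidTracks w ∧ fibVal (track 0 w) + fibVal (track 1 w) = fibVal (track 2 w) := by
  have e : fibVal (track 0 w) + fibVal (track 1 w) = fibVal (track 2 w) ↔
      lin addCoeff w = 0 := by
    rw [lin_addCoeff]; omega
  rw [e, DFA.mem_accepts]
  constructor
  · rintro ⟨s, hs, h0⟩
    have := (addAuto_eval_spec w).1 s hs
    exact ⟨this.valid, this.val ▸ h0⟩
  · rintro ⟨hv, h0⟩
    obtain ⟨s, hs⟩ := (addAuto_eval_spec w).2 hv (by
      rintro p ⟨v, rfl⟩
      exact lin_addCoeff_mem_Icc hv h0)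
    exact ⟨s, hs, ((addAuto_eval_spec w).1 s hs).val.trans h0⟩

/-! ### Correctness of the translation -/

theorem compile_isMinimal {k : ℕ} (φ : Formula k) : (compile φ).aut.IsMinimal := by
  cases φ <;> rw [compile] <;> exact minimize_isMinimal _

theorem mem_compile_accepts {k : ℕ} (φ : Formula k) (w : List (Fin k → Bool)) :
    w ∈ (compile φ).aut.dfa.accepts ↔
      ValidTracks w ∧ φ.Holds fun i => fibVal (track i w) := by
  induction φ with
  | isZero => rw [compile, minimize_accepts, mem_zeroAuto_accepts]; rfl
  | isOne => rw [compile, minimize_accepts, mem_oneAuto_accepts]; rfl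
  | add => rw [compile, minimize_accepts, mem_addAuto_accepts]; rfl
  | @conj i j k f φ g ψ used ihφ ihψ =>
    rw [compile]
    change w ∈ (minimize _).aut.dfa.accepts ↔ _
    rw [minimize_accepts, mem_product_accepts, ihφ, ihψ]
    simp only [ValidTracks, track_map_comp, Formula.Holds]
    constructor
    · rintro ⟨⟨h1, h2⟩, h3, h4⟩
      refine ⟨fun t => ?_, h2, h4⟩
      rcases used t with ⟨s, rfl⟩ | ⟨s, rfl⟩
      · exact h1 s
      · exact h3 s
    · rintro ⟨h, h2, h4⟩
      exact ⟨⟨fun s => h _, h2⟩, fun s => h _, h4⟩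
  | @ex k φ ih =>
    rw [compile]
    change w ∈ (minimize _).aut.dfa.accepts ↔ _
    rw [minimize_accepts, mem_determinize_accepts]
    have hcons : ∀ (m : ℕ) (W : List (Fin (k + 1) → Bool)),
        W.map Fin.tail = List.replicate m (zeroLetter k) ++ w →
        (W ∈ (compile φ).aut.dfa.accepts ↔ (IsFibRep (track 0 W) ∧ ValidTracks w) ∧
          φ.Holds (Fin.cons (fibVal (track 0 W)) fun i => fibVal (track i w))) := by
      intro m W hW
      rw [ih]
      have h1 : ValidTracks W ↔ IsFibRep (track 0 W) ∧ ValidTracks w := by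
        simp only [ValidTracks, Fin.forall_fin_succ, track_succ, hW, track_replicate_append,
          isFibRep_replicate_append]
      have h2 : (fun i => fibVal (track i W)) =
          (Fin.cons (fibVal (track 0 W)) fun i => fibVal (track i w) : Fin (k + 1) → ℕ) := by
        funext i
        refine Fin.cases rfl (fun i => ?_) i
        simp only [track_succ, hW, track_replicate_append, fibVal_replicate_append, Fin.cons_succ]
      rw [h1, h2]
    constructor
    · rintro ⟨m, W, hW, hacc⟩
      obtain ⟨⟨-, hv⟩, hφ⟩ := (hcons m W hW).1 hacc
      exact ⟨hv, _, hφ⟩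
    · rintro ⟨hv, n, hn⟩
      obtain ⟨y, hy, -, rfl⟩ := exists_isFibRep n
      -- Each of the witness `y` and the word `w` is padded by the length of the other, so that the
      -- tracks have equal length.
      obtain ⟨W, hW, hW0⟩ := exists_word_of_tracks (List.replicate w.length false ++ y)
        (List.replicate y.length (zeroLetter k) ++ w) (by simp [add_comm])
      refine ⟨_, W, hW, (hcons _ W hW).2 ?_⟩
      rw [hW0, isFibRep_replicate_append, fibVal_replicate_append]
      exact ⟨⟨hy, hv⟩, hn⟩

/-! ### Projecting a number that is determined by a linear equation -/

section Linear

variable {k : ℕ}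

/-- Along a word that can be completed to a solution of a linear equation, the linear form and its
shift stay bounded. -/
theorem exists_bound_lin (β : Fin k → ℤ) (γ : ℤ) : ∃ K : ℤ, ∀ W V : List (Fin k → Bool),
    ValidTracks (W ++ V) → lin β (W ++ V) = γ → |lin β W| ≤ K ∧ |linShift β W| ≤ K := by
  obtain ⟨g1, g2⟩ := goldenRatio_bounds
  have hg := Real.goldenRatio_sq
  set g := Real.goldenRatio
  set s : ℤ := ∑ i, |β i| with hs
  have hs0 : 0 ≤ s := Finset.sum_nonneg fun i _ => abs_nonneg _
  have hs0' : (0 : ℝ) ≤ s := by exact_mod_cast hs0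
  -- The errors sum to at most `s`, which gives `|γ| + 3s` for the form; multiplying by `g < 1.62`
  -- and adding `s` bounds the shift.
  refine ⟨2 * |γ| + 7 * s, fun W V hv h0 => ?_⟩
  have he : |(linShift β W : ℝ) - g * lin β W| ≤ s := by
    have : (linShift β W : ℝ) - g * lin β W =
        ∑ i, (β i : ℝ) * (fibShift (track i W) - g * fibVal (track i W)) := by
      simp only [lin, linShift]
      push_cast
      rw [Finset.mul_sum, ← Finset.sum_sub_distrib]
      exact Finset.sum_congr rfl fun i _ => by ring
    rw [this, hs]
    push_cast
    refine (Finset.abs_sum_le_sum_abs _ _).trans (Finset.sum_le_sum fun i _ => ?_)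
    rw [abs_mul]
    refine mul_le_of_le_one_right (abs_nonneg _) ?_
    have hb := (hv.of_append i).fibShift_sub_bounds hg g1 (by linarith)
    rw [abs_le]
    refine ⟨by linarith [hb.1], hb.2.trans ?_⟩
    split_ifs <;> linarith
  have hu : |(lin β W : ℝ)| ≤ |(γ : ℝ)| + 3 * s := by
    rcases V.length.eq_zero_or_pos with hl | hl
    · rw [List.length_eq_zero_iff.1 hl, List.append_nil] at h0
      rw [h0]; linarith
    obtain ⟨n, hn⟩ := Nat.exists_eq_add_of_lt hl
    rw [zero_add] at hn
    rw [lin_append_of_length _ _ _ n hn] at h0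
    have hd : |(lin β V : ℝ)| ≤ s * (2 * Nat.fib (n + 1) + Nat.fib n) := by
      rw [hs, lin]
      push_cast
      rw [Finset.sum_mul]
      refine (Finset.abs_sum_le_sum_abs _ _).trans (Finset.sum_le_sum fun i _ => ?_)
      rw [abs_mul]
      refine mul_le_mul_of_nonneg_left ?_ (abs_nonneg _)
      rw [Nat.abs_cast]
      have := (hv.append_right i).fibVal_lt
      rw [track_length, hn, show n + 1 + 2 = (n + 1) + 2 by ring, Nat.fib_add_two,
        Nat.fib_add_two (n := n)] at this
      have : fibVal (track i V) ≤ 2 * Nat.fib (n + 1) + Nat.fib n := by omega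
      exact_mod_cast this
    have hA : (1 : ℝ) ≤ Nat.fib (n + 1) := by
      exact_mod_cast Nat.fib_pos.2 (Nat.succ_pos n)
    have hB : (0 : ℝ) ≤ Nat.fib n := Nat.cast_nonneg _
    have h0' : (Nat.fib (n + 1) : ℝ) * linShift β W + Nat.fib n * lin β W + lin β V = γ := by
      exact_mod_cast h0
    generalize (Nat.fib (n + 1) : ℝ) = A at *
    generalize (Nat.fib n : ℝ) = B at *
    have hpos : 0 < A * g + B := by nlinarith
    refine le_of_mul_le_mul_left ?_ hpos
    rw [← abs_of_pos hpos, ← abs_mul, abs_of_pos hpos]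
    -- Replacing the shift by `g` times the form plus a bounded error isolates the form, with the
    -- large factor `Ag + B`.
    have e : (A * g + B) * lin β W = γ - lin β V - A * (linShift β W - g * lin β W) := by
      linear_combination h0'
    rw [e]
    calc _ ≤ |(γ : ℝ)| + |(lin β V : ℝ)| + |A * (linShift β W - g * lin β W)| :=
          (abs_sub _ _).trans (add_le_add_left (abs_sub _ _) _)
      _ ≤ |(γ : ℝ)| + s * (2 * A + B) + A * s := by
          rw [abs_mul, abs_of_nonneg (by linarith : 0 ≤ A)]
          gcongr
      _ ≤ _ := by
          have h1 : (1 : ℝ) ≤ A * g + B := by nlinarith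
          have h2 : 3 * A + B ≤ 3 * (A * g + B) := by nlinarith
          have m1 := mul_le_mul_of_nonneg_right h1 (abs_nonneg (γ : ℝ))
          have m2 := mul_le_mul_of_nonneg_left h2 hs0'
          linarith
  have hv : |(linShift β W : ℝ)| ≤ 2 * |(γ : ℝ)| + 7 * s := by
    rw [abs_le] at he hu ⊢
    have := abs_nonneg (γ : ℝ)
    constructor <;> nlinarith
  constructor
  · have : |(lin β W : ℝ)| ≤ 2 * |(γ : ℝ)| + 7 * s := by
      have := abs_nonneg (γ : ℝ)
      linarith
    exact_mod_cast this
  · exact_mod_cast hv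

/-! ### Bounded data that determine states and subsets -/

/-- Up to leading zeros `y ++ z` is `r`, so `y` is what remains after cutting off `z.length` digits.
Truncated subtraction is right here: if `z` is longer than `r`, then `y` consists of zeros. -/
theorem fibVal_prefix_eq {y z r : List Bool} (h : IsFibRep (y ++ z)) (hr : IsFibRep r)
    (he : fibVal (y ++ z) = fibVal r) : fibVal y = fibVal (r.take (r.length - z.length)) := by
  have hp := h.pad_eq hr he
  rw [← List.append_assoc] at hp
  rcases le_total z.length r.length with hl | hl
  · have hd : (r.drop (r.length - z.length)).length = z.length := by simp; omega
    have e : ∀ l : List Bool, l ++ r =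
        (l ++ r.take (r.length - z.length)) ++ r.drop (r.length - z.length) := fun l => by
      rw [List.append_assoc, List.take_append_drop]
    rw [e (List.replicate (y ++ z).length false)] at hp
    have := (List.append_inj' hp hd.symm).1
    rw [← fibVal_replicate_append _ y, this, fibVal_replicate_append]
  · have hd : (List.replicate (z.length - r.length) false ++ r).length = z.length := by simp; omega
    have e : List.replicate (y ++ z).length false ++ r =
        List.replicate (y.length + r.length) false ++
          (List.replicate (z.length - r.length) false ++ r) := by
      rw [← List.append_assoc, List.replicate_append_replicate, List.length_append]
      congr 2
      omega
    rw [e] at hp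
    have := (List.append_inj' hp hd.symm).1
    rw [← fibVal_replicate_append _ y, this, Nat.sub_eq_zero_of_le hl, fibVal_replicate]
    rfl

theorem lin_succ (β : Fin (k + 1) → ℤ) (W : List (Fin (k + 1) → Bool)) :
    lin β W = β 0 * fibVal (track 0 W) + lin (Fin.tail β) (W.map Fin.tail) := by
  simp only [lin, Fin.sum_univ_succ, track_succ]
  rfl

theorem linShift_succ (β : Fin (k + 1) → ℤ) (W : List (Fin (k + 1) → Bool)) :
    linShift β W = β 0 * fibShift (track 0 W) + linShift (Fin.tail β) (W.map Fin.tail) := by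
  simp only [linShift, Fin.sum_univ_succ, track_succ]
  rfl

theorem lin_replicate_append (β : Fin k → ℤ) (m : ℕ) (x : List (Fin k → Bool)) :
    lin β (List.replicate m (zeroLetter k) ++ x) = lin β x := by
  simp only [lin, track_replicate_append, fibVal_replicate_append]

theorem linShift_replicate_append (β : Fin k → ℤ) (m : ℕ) (x : List (Fin k → Bool)) :
    linShift β (List.replicate m (zeroLetter k) ++ x) = linShift β x := by
  simp only [linShift, track_replicate_append, fibShift_replicate_append]

theorem validTracks_replicate_append (m : ℕ) (x : List (Fin k → Bool)) :
    ValidTracks (List.replicate m (zeroLetter k) ++ x) ↔ ValidTracks x := by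
  simp only [ValidTracks, track_replicate_append, isFibRep_replicate_append]

theorem validTracks_succ (W : List (Fin (k + 1) → Bool)) :
    ValidTracks W ↔ IsFibRep (track 0 W) ∧ ValidTracks (W.map Fin.tail) := by
  simp only [ValidTracks, Fin.forall_fin_succ, track_succ]

/-- Automaton `A` recognizes the solutions of `∑ βᵢ xᵢ = γ` with `x₀ = c`. -/
def RecognizesLinear (A : Auto k) (i : Fin k) (c : ℕ) (β : Fin k → ℤ) (γ : ℤ) : Prop :=
  ∀ W, W ∈ A.dfa.accepts ↔ ValidTracks W ∧ fibVal (track i W) = c ∧ lin β W = γ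

/-- The listed data decide which continuations are accepted, and a minimal automaton has one state
for each such set of continuations. -/
theorem Auto.IsMinimal.eval_eq {A : Auto k} (h : A.IsMinimal) {i : Fin k} {c : ℕ}
    {β : Fin k → ℤ} {γ : ℤ} (hA : RecognizesLinear A i c β γ) {W W' : List (Fin k → Bool)}
    (hvalid : ∀ j, IsFibRep (track j W) ↔ IsFibRep (track j W'))
    (hlast : ∀ j, lastBit (track j W) = lastBit (track j W'))
    (hval : fibVal (track i W) = fibVal (track i W'))
    (hshift : fibShift (track i W) = fibShift (track i W'))
    (hlin : lin β W = lin β W') (hlinShift : linShift β W = linShift β W') :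
    A.dfa.eval W = A.dfa.eval W' := by
  apply h.reduced
  ext V
  have key : W ++ V ∈ A.dfa.accepts ↔ W' ++ V ∈ A.dfa.accepts := by
    rw [hA, hA]
    have h1 : ValidTracks (W ++ V) ↔ ValidTracks (W' ++ V) := by
      simp only [ValidTracks, track_append]
      refine forall_congr' fun j => ?_
      rw [isFibRep_append, isFibRep_append, hvalid, hlast]
    have h2 : fibVal (track i (W ++ V)) = fibVal (track i (W' ++ V)) := by
      rw [track_append, track_append, fibVal_append_congr hval hshift]
    have h3 : lin β (W ++ V) = lin β (W' ++ V) := by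
      rcases V.length.eq_zero_or_pos with hl | hl
      · simpa [List.length_eq_zero_iff.1 hl] using hlin
      · obtain ⟨n, hn⟩ := Nat.exists_eq_add_of_lt hl
        rw [zero_add] at hn
        rw [lin_append_of_length _ _ _ n hn, lin_append_of_length _ _ _ n hn, hlin, hlinShift]
    rw [h1, h2, h3]
  rw [DFA.mem_accepts, DFA.mem_accepts, DFA.eval, DFA.evalFrom_of_append,
    DFA.evalFrom_of_append] at key
  exact key

theorem Auto.IsMinimal.eval_eq_of_tail {A : Auto (k + 1)} (h : A.IsMinimal) {c : ℕ}
    {β : Fin (k + 1) → ℤ} {γ : ℤ} (hA : RecognizesLinear A 0 c β γ)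
    {W W' : List (Fin (k + 1) → Bool)} {m m' : ℕ} {x x' : List (Fin k → Bool)}
    (hW : W.map Fin.tail = List.replicate m (zeroLetter k) ++ x)
    (hW' : W'.map Fin.tail = List.replicate m' (zeroLetter k) ++ x')
    (hvalid : ∀ j, IsFibRep (track j x) ↔ IsFibRep (track j x'))
    (hlast : ∀ j, lastBit (track j x) = lastBit (track j x'))
    (hlin : lin (Fin.tail β) x = lin (Fin.tail β) x')
    (hlinShift : linShift (Fin.tail β) x = linShift (Fin.tail β) x')
    (hvalid0 : IsFibRep (track 0 W) ↔ IsFibRep (track 0 W'))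
    (hlast0 : lastBit (track 0 W) = lastBit (track 0 W'))
    (hval : fibVal (track 0 W) = fibVal (track 0 W'))
    (hshift : fibShift (track 0 W) = fibShift (track 0 W')) :
    A.dfa.eval W = A.dfa.eval W' := by
  refine h.eval_eq hA ?_ ?_ hval hshift ?_ ?_
  · intro j
    refine Fin.cases hvalid0 (fun j => ?_) j
    rw [track_succ, track_succ, hW, hW', track_replicate_append, track_replicate_append,
      isFibRep_replicate_append, isFibRep_replicate_append, hvalid]
  · intro j
    refine Fin.cases hlast0 (fun j => ?_) j
    rw [track_succ, track_succ, hW, hW', track_replicate_append, track_replicate_append,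
      lastBit_replicate_append, lastBit_replicate_append, hlast]
  · rw [lin_succ, lin_succ, hW, hW', lin_replicate_append, lin_replicate_append, hval, hlin]
  · rw [linShift_succ, linShift_succ, hW, hW', linShift_replicate_append,
      linShift_replicate_append, hshift, hlinShift]

theorem Auto.IsMinimal.eq_of_dead {A : Auto k} (h : A.IsMinimal) {p q : A.State}
    (hp : ∀ V, V ∉ A.dfa.acceptsFrom p) (hq : ∀ V, V ∉ A.dfa.acceptsFrom q) : p = q :=
  h.reduced p q (by ext V; exact iff_of_false (hp V) (hq V))

theorem mem_acceptsFrom_eval {A : Auto k} {W V : List (Fin k → Bool)} :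
    V ∈ A.dfa.acceptsFrom (A.dfa.eval W) ↔ W ++ V ∈ A.dfa.accepts := by
  rw [DFA.mem_acceptsFrom, DFA.mem_accepts, DFA.eval, DFA.evalFrom_of_append]

/-- The subsets that occur in the subset construction have bounded size. -/
theorem exists_bound_ncard (β : Fin (k + 1) → ℤ) (γ : ℤ) (hβ : β 0 ≠ 0) :
    ∃ K : ℕ, ∀ (c : ℕ) (A : Auto (k + 1)), A.IsMinimal → RecognizesLinear A 0 c β γ →
      ∀ x, ((project A).eval x).ncard ≤ K := by
  obtain ⟨K, hK⟩ := exists_bound_lin β γ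
  refine ⟨(Finset.Icc (-K) K).insertNone.card, fun c A hmin hA x => ?_⟩
  -- States are encoded injectively: `none` for the unique dead state, otherwise the bounded value
  -- of the linear form.
  have hex : ∀ q ∈ (project A).eval x, ∃ o : Option ℤ,
      (o = none ∧ ∀ V, V ∉ A.dfa.acceptsFrom q) ∨
      ∃ u m W, o = some u ∧ |u| ≤ K ∧ u = lin β W ∧ IsFibRep (track 0 W) ∧
        W.map Fin.tail = List.replicate m (zeroLetter k) ++ x ∧ A.dfa.eval W = q := by
    intro q hq
    by_cases hd : ∀ V, V ∉ A.dfa.acceptsFrom q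
    · exact ⟨none, .inl ⟨rfl, hd⟩⟩
    · push Not at hd
      obtain ⟨V, hV⟩ := hd
      obtain ⟨m, W, hW, rfl⟩ := (mem_project_eval A x q).1 hq
      obtain ⟨hv, -, hl⟩ := (hA _).1 (mem_acceptsFrom_eval.1 hV)
      exact ⟨_, .inr ⟨_, m, W, rfl, (hK W V hv hl).1, rfl, hv.of_append 0, hW, rfl⟩⟩
  choose! f hf using hex
  rw [← Set.ncard_coe_finset]
  refine Set.ncard_le_ncard_of_injOn f ?_ ?_ (Finset.finite_toSet _)
  · intro q hq
    rcases hf q hq with ⟨h, -⟩ | ⟨u, m, W, h, hu, -⟩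
    · rw [h]; simp
    · rw [h]
      simpa using abs_le.1 hu
  · intro q hq q' hq' he
    rcases hf q hq with ⟨h, hd⟩ | ⟨u, m, W, h, -, hu, hv, hW, rfl⟩ <;>
    rcases hf q' hq' with ⟨h', hd'⟩ | ⟨u', m', W', h', -, hu', hv', hW', rfl⟩
    · exact hmin.eq_of_dead hd hd'
    · rw [he, h'] at h; simp at h
    · rw [he, h'] at h; simp at h
    · rw [he, h'] at h
      have huu := Option.some.inj h
      rw [hu, hu', lin_succ, lin_succ, hW, hW', lin_replicate_append, lin_replicate_append] at huu
      -- The free tracks contribute the same amount to both forms, so `β 0 ≠ 0` yields the value of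
      -- the bound track, hence by Zeckendorf its shift and last digit.
      have hval : fibVal (track 0 W) = fibVal (track 0 W') := by
        have := mul_left_cancel₀ hβ (add_right_cancel huu)
        exact_mod_cast this.symm
      exact hmin.eval_eq_of_tail hA hW hW' (fun _ => Iff.rfl) (fun _ => rfl) rfl rfl
        (iff_of_true hv hv') (hv.lastBit_eq hv' hval) hval (hv.fibShift_eq hv' hval)

/-- The number of subsets that occur in the subset construction is logarithmic. -/
theorem exists_bound_card_reach (β : Fin (k + 1) → ℤ) (γ : ℤ) :
    ∃ K : ℕ, ∀ (c : ℕ) (A : Auto (k + 1)), A.IsMinimal → RecognizesLinear A 0 c β γ →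
      Fintype.card (Reach (project A).toDFA) ≤ K * (c.size + 1) := by
  obtain ⟨K, hK⟩ := exists_bound_lin β γ
  set I := Finset.Icc (-K) K
  refine ⟨2 * (I.card * I.card * 2 ^ k) + 1, fun c A hmin hA => ?_⟩
  obtain ⟨r, hr, hrl, hrv⟩ := exists_isFibRep c
  -- The code of a subset with a live member: the number of digits of `r` already read, the linear
  -- form, its shift, and the last letters of the free tracks. The code `none` stands for the subset
  -- consisting of the dead state alone.
  set T : Finset (Option (ℕ × ℤ × ℤ × (Fin k → Bool))) :=
    (Finset.range (2 * c.size + 1) ×ˢ I ×ˢ I ×ˢ Finset.univ).insertNone with hT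
  have hTc : T.card ≤ (2 * (I.card * I.card * 2 ^ k) + 1) * (c.size + 1) := by
    rw [hT, Finset.card_insertNone, Finset.card_product, Finset.card_product,
      Finset.card_product, Finset.card_range, Finset.card_univ, card_letters]
    ring_nf
    omega
  refine le_trans ?_ hTc
  have hex : ∀ S : Reach (project A).toDFA, ∃ o : Option (ℕ × ℤ × ℤ × (Fin k → Bool)),
      (o = none ∧ S.1.Nonempty ∧ ∀ q ∈ S.1, ∀ V, V ∉ A.dfa.acceptsFrom q) ∨
      ∃ x m W V, o = some (r.length - V.length, lin β W, linShift β W,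
          fun j => lastBit (track j x)) ∧ S.1 = (project A).eval x ∧ W ++ V ∈ A.dfa.accepts ∧
        W.map Fin.tail = List.replicate m (zeroLetter k) ++ x := by
    rintro ⟨S, x, hx⟩
    have hx' : S = (project A).eval x := hx.symm
    subst hx'
    by_cases hd : ∀ q ∈ (project A).eval x, ∀ V, V ∉ A.dfa.acceptsFrom q
    · refine ⟨none, .inl ⟨rfl, ?_, hd⟩⟩
      obtain ⟨W, hW, -⟩ := exists_word_of_tracks (List.replicate x.length false) x (by simp)
      exact ⟨_, (mem_project_eval A x _).2 ⟨0, W, by simpa using hW, rfl⟩⟩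
    · push Not at hd
      obtain ⟨q, hq, V, hV⟩ := hd
      obtain ⟨m, W, hW, rfl⟩ := (mem_project_eval A x q).1 hq
      exact ⟨_, .inr ⟨x, m, W, V, rfl, rfl, mem_acceptsFrom_eval.1 hV, hW⟩⟩
  choose f hf using hex
  rw [← Finset.card_univ]
  refine Finset.card_le_card_of_injOn f ?_ ?_
  · intro S _
    rcases hf S with ⟨h, -⟩ | ⟨x, m, W, V, h, -, hacc, -⟩
    · rw [h, hT]; simp
    · obtain ⟨hv, -, hl⟩ := (hA _).1 hacc
      obtain ⟨b1, b2⟩ := hK W V hv hl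
      rw [h, hT]
      simp only [Finset.mem_coe, Finset.some_mem_insertNone, Finset.mem_product,
        Finset.mem_range, Finset.mem_univ, and_true, I, Finset.mem_Icc]
      exact ⟨by omega, abs_le.1 b1, abs_le.1 b2⟩
  · intro S _ S' _ he
    rcases hf S with ⟨h, hne, hd⟩ | ⟨x, m, W, V, h, hS, hacc, hW⟩ <;>
    rcases hf S' with ⟨h', hne', hd'⟩ | ⟨x', m', W', V', h', hS', hacc', hW'⟩
    · obtain ⟨q, hq⟩ := hne
      obtain ⟨q', hq'⟩ := hne'
      apply Subtype.ext
      ext p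
      constructor
      · intro hp
        rwa [hmin.eq_of_dead (hd p hp) (hd' q' hq')]
      · intro hp
        rwa [hmin.eq_of_dead (hd' p hp) (hd q hq)]
    · rw [he, h'] at h; simp at h
    · rw [he, h'] at h; simp at h
    · rw [he, h'] at h
      simp only [Option.some.injEq, Prod.mk.injEq] at h
      obtain ⟨hj, hu, hv, hl⟩ := h
      have hl := fun j => congrFun hl j
      obtain ⟨v1, c1, -⟩ := (hA _).1 hacc
      obtain ⟨v2, c2, -⟩ := (hA _).1 hacc'
      have w1 := v1.of_append
      have w2 := v2.of_append
      have p1 := v1 0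
      have p2 := v2 0
      rw [track_append] at c1 c2 p1 p2
      have q1 := fibVal_prefix_eq p1 hr (c1.trans hrv.symm)
      have q2 := fibVal_prefix_eq p2 hr (c2.trans hrv.symm)
      rw [track_length] at q1 q2
      -- Both bound tracks are prefixes of the padded `r` with the same value. Subtracting their
      -- contribution leaves equal forms and shifts on the free tracks.
      have hval : fibVal (track 0 W) = fibVal (track 0 W') := by rw [q1, q2, hj]
      have hshift := (w1 0).fibShift_eq (w2 0) hval
      rw [lin_succ, lin_succ, hW, hW', lin_replicate_append, lin_replicate_append, hval] at hu
      rw [linShift_succ, linShift_succ, hW, hW', linShift_replicate_append,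
        linShift_replicate_append, hshift] at hv
      have hu := add_left_cancel hu
      have hv := add_left_cancel hv
      have vx : ValidTracks x := by
        have := ((validTracks_succ W).1 w1).2
        rwa [hW, validTracks_replicate_append] at this
      have vx' : ValidTracks x' := by
        have := ((validTracks_succ W').1 w2).2
        rwa [hW', validTracks_replicate_append] at this
      -- Free words with the same data reach the same subset: any bound track used with `y` can be
      -- used with `y'`, after padding, and leads to the same state.
      have key : ∀ y y' : List (Fin k → Bool), ValidTracks y → ValidTracks y' →
          lin (Fin.tail β) y = lin (Fin.tail β) y' →
          linShift (Fin.tail β) y = linShift (Fin.tail β) y' →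
          (∀ j, lastBit (track j y) = lastBit (track j y')) →
          (project A).eval y ⊆ (project A).eval y' := by
        intro y y' hy hy' h1 h2 h3 q hq
        obtain ⟨n, Z, hZ, rfl⟩ := (mem_project_eval A y q).1 hq
        obtain ⟨Z', hZ', hZ0⟩ := exists_word_of_tracks
          (List.replicate y'.length false ++ track 0 Z)
          (List.replicate Z.length (zeroLetter k) ++ y') (by simp [track_length, add_comm])
        refine (mem_project_eval A y' _).2 ⟨_, Z', hZ', ?_⟩
        refine (hmin.eval_eq_of_tail hA hZ hZ' (fun j => iff_of_true (hy j) (hy' j)) h3 h1 h2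
          ?_ ?_ ?_ ?_).symm
        · rw [hZ0, isFibRep_replicate_append]
        · rw [hZ0, lastBit_replicate_append]
        · rw [hZ0, fibVal_replicate_append]
        · rw [hZ0, fibShift_replicate_append]
      apply Subtype.ext
      rw [hS, hS']
      exact Set.Subset.antisymm (key x x' vx vx' hu.symm hv.symm fun j => (hl j).symm)
        (key x' x vx' vx hu hv hl)

end Linear
/-! ### The time of the construction steps -/

/-- The quasi-linear function `n log n`, up to rounding. -/
def quasiLinear (n : ℕ) : ℕ := n * (Nat.log 2 n + 1)

theorem quasiLinear_mono {m n : ℕ} (h : m ≤ n) : quasiLinear m ≤ quasiLinear n :=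
  Nat.mul_le_mul h (Nat.add_le_add_right (Nat.log_mono_right h) 1)

theorem le_quasiLinear (n : ℕ) : n ≤ quasiLinear n := Nat.le_mul_of_pos_right n (Nat.succ_pos _)

theorem quasiLinear_mul_le (K n : ℕ) : quasiLinear (K * n) ≤ K * (K + 1) * quasiLinear n := by
  rcases n.eq_zero_or_pos with rfl | hn
  · simp [quasiLinear]
  have hpow : ∀ m, Nat.log 2 (2 ^ m * n) = Nat.log 2 n + m := by
    intro m
    induction m with
    | zero => simp
    | succ m ih =>
      rw [pow_succ, mul_right_comm, Nat.log_mul_base one_lt_two (by positivity), ih, add_assoc]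
  have h : Nat.log 2 (K * n) ≤ Nat.log 2 n + K := by
    rw [← hpow]
    exact Nat.log_mono_right (Nat.mul_le_mul_right n Nat.lt_two_pow_self.le)
  calc quasiLinear (K * n) ≤ K * n * (Nat.log 2 n + K + 1) := by unfold quasiLinear; gcongr
    _ ≤ K * n * ((K + 1) * (Nat.log 2 n + 1)) := by
      gcongr
      nlinarith [Nat.zero_le (K * Nat.log 2 n)]
    _ = _ := by unfold quasiLinear; ring

theorem minimize_time_le_quasiLinear {k : ℕ} (A : Auto k) :
    (minimize A).time ≤ 5 * 2 ^ k * quasiLinear (Fintype.card A.State) := by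
  refine (minimize_time_le A).trans ?_
  have : Nat.log 2 (Fintype.card A.State) + 5 ≤ 5 * (Nat.log 2 (Fintype.card A.State) + 1) := by
    omega
  calc _ ≤ 2 ^ k * (Fintype.card A.State * (5 * (Nat.log 2 (Fintype.card A.State) + 1))) := by
        gcongr
    _ = _ := by unfold quasiLinear; ring

section Conj

variable {i j k : ℕ} (f : Fin i → Fin k) (A : Timed i) (g : Fin j → Fin k) (B : Timed j)

theorem card_product_state : Fintype.card (product f A.aut g B.aut).State =
    Fintype.card A.aut.State * Fintype.card B.aut.State :=
  Fintype.card_prod _ _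

theorem card_conjStep_le : Fintype.card (conjStep f A g B).aut.State ≤
    Fintype.card A.aut.State * Fintype.card B.aut.State :=
  (card_minimize_le _).trans (card_product_state f A g B).le

theorem conjStep_time_le : (conjStep f A g B).time ≤ A.time + B.time +
    6 * 2 ^ k * quasiLinear (Fintype.card A.aut.State * Fintype.card B.aut.State) := by
  have h1 := minimize_time_le_quasiLinear (product f A.aut g B.aut)
  rw [card_product_state] at h1
  have h2 := Nat.mul_le_mul_right (2 ^ k)
    (le_quasiLinear (Fintype.card A.aut.State * Fintype.card B.aut.State))
  have h3 : (conjStep f A g B).time = A.time + B.time +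
      Fintype.card (product f A.aut g B.aut).State * 2 ^ k +
      (minimize (product f A.aut g B.aut)).time := rfl
  rw [h3, card_product_state]
  linarith

end Conj

/-- The constant depends only on the equation. The state bound involves `c` alone and not the size
of `A`, which is what keeps iterated quantification under control. -/
theorem exists_bound_exStep {k : ℕ} (β : Fin (k + 1) → ℤ) (γ : ℤ) (hβ : β 0 ≠ 0) :
    ∃ K : ℕ, ∀ (c : ℕ) (A : Timed (k + 1)), A.aut.IsMinimal → RecognizesLinear A.aut 0 c β γ →
      Fintype.card (exStep A).aut.State ≤ K * (c.size + 1) ∧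
      (exStep A).time ≤ A.time + K * quasiLinear (Fintype.card A.aut.State) +
        K * quasiLinear (c.size + 1) := by
  obtain ⟨K₁, h₁⟩ := exists_bound_ncard β γ hβ
  obtain ⟨K₂, h₂⟩ := exists_bound_card_reach β γ
  refine ⟨2 ^ (k + 1) + 2 + (K₂ * (2 ^ k * (1 + 2 * K₁)) + 5 * 2 ^ k * (K₂ * (K₂ + 1)) + K₂),
    fun c A hmin hA => ?_⟩
  have hR := h₂ c A.aut hmin hA
  set N := c.size + 1
  set n := Fintype.card A.aut.State
  set R := Fintype.card (Reach (project A.aut).toDFA)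
  have hcard : Fintype.card (exStep A).aut.State ≤ R := card_minimize_le (determinize A.aut)
  have hmint : (minimize (determinize A.aut)).time ≤ 5 * 2 ^ k * quasiLinear R :=
    minimize_time_le_quasiLinear (determinize A.aut)
  have hq : quasiLinear R ≤ K₂ * (K₂ + 1) * quasiLinear N :=
    (quasiLinear_mono hR).trans (quasiLinear_mul_le _ _)
  have hsum : (∑ S : Reach (project A.aut).toDFA, ∑ _a : Fin k → Bool, (1 + 2 * S.1.ncard)) ≤
      R * (2 ^ k * (1 + 2 * K₁)) := by
    change _ ≤ Fintype.card (Reach (project A.aut).toDFA) • (2 ^ k * (1 + 2 * K₁))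
    rw [← Finset.card_univ]
    refine Finset.sum_le_card_nsmul _ _ _ fun S _ => ?_
    rw [Finset.sum_const, Finset.card_univ, card_letters, smul_eq_mul]
    obtain ⟨S, x, rfl⟩ := S
    have : ((project A.aut).toDFA.eval x).ncard ≤ K₁ := h₁ c A.aut hmin hA x
    simp only
    gcongr
  have htime : (exStep A).time = A.time + n * 2 ^ (k + 1) + n * 2 +
    (∑ S : Reach (project A.aut).toDFA, ∑ _a : Fin k → Bool, (1 + 2 * S.1.ncard)) +
    (minimize (determinize A.aut)).time := rfl
  constructor
  · refine hcard.trans (hR.trans (Nat.mul_le_mul_right N ?_))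
    exact (Nat.le_add_left _ _).trans (Nat.le_add_left _ _)
  · rw [htime]
    have e1 : n * 2 ^ (k + 1) + n * 2 ≤ (2 ^ (k + 1) + 2) * quasiLinear n := by
      rw [← mul_add, mul_comm]
      exact Nat.mul_le_mul_left _ (le_quasiLinear n)
    have e2 : R * (2 ^ k * (1 + 2 * K₁)) ≤ K₂ * (2 ^ k * (1 + 2 * K₁)) * quasiLinear N := by
      calc _ ≤ K₂ * N * (2 ^ k * (1 + 2 * K₁)) := by gcongr
        _ = K₂ * (2 ^ k * (1 + 2 * K₁)) * N := by ring
        _ ≤ _ := by gcongr; exact le_quasiLinear N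
    have e3 : 5 * 2 ^ k * quasiLinear R ≤ 5 * 2 ^ k * (K₂ * (K₂ + 1)) * quasiLinear N := by
      rw [mul_assoc (5 * 2 ^ k)]
      gcongr
    generalize quasiLinear n = Qn at *
    generalize quasiLinear N = QN at *
    generalize 2 ^ (k + 1) + 2 = a at *
    generalize K₂ * (2 ^ k * (1 + 2 * K₁)) = b at *
    generalize 5 * 2 ^ k * (K₂ * (K₂ + 1)) = d at *
    have : a * Qn + (b * QN + d * QN) ≤ (a + (b + d + K₂)) * Qn + (a + (b + d + K₂)) * QN := by
      nlinarith [Nat.zero_le ((b + d + K₂) * Qn), Nat.zero_le ((a + K₂) * QN)]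
    omega

theorem exists_bound_ex {k : ℕ} (β : Fin (k + 1) → ℤ) (γ : ℤ) (hβ : β 0 ≠ 0) :
    ∃ K : ℕ, ∀ (c : ℕ) (θ : Formula (k + 1)),
      (∀ v : Fin (k + 1) → ℕ, θ.Holds v ↔ v 0 = c ∧ ∑ i, β i * (v i : ℤ) = γ) →
      Fintype.card (compile (.ex θ)).aut.State ≤ K * (c.size + 1) ∧
      (compile (.ex θ)).time ≤ (compile θ).time +
        K * quasiLinear (Fintype.card (compile θ).aut.State) + K * quasiLinear (c.size + 1) := by
  obtain ⟨K, hK⟩ := exists_bound_exStep β γ hβ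
  refine ⟨K, fun c θ hθ => ?_⟩
  rw [compile]
  refine hK c (compile θ) (compile_isMinimal θ) fun W => ?_
  rw [mem_compile_accepts, hθ]
  rfl

/-! ### The formulas for `x = c` and `x + c = z` -/

theorem eqConst_zero : eqConst 0 = .isZero := by rw [eqConst]; rfl

/-- The body of the formula for `x = 2c`. -/
def doubleBody (c : ℕ) : Formula 2 :=
  .conj (k := 2) ![0] (eqConst c) ![0, 0, 1] .add (by decide)

/-- The body of the formula for `x = c + 1`. -/
def succBody (c : ℕ) : Formula 2 :=
  .conj (k := 2) ![0] (eqConst c) ![0, 1] succFormula (by decide)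

/-- The body of the formula for `x + c = z`. -/
def addBody (c : ℕ) : Formula 3 :=
  .conj (k := 3) ![1, 0, 2] .add ![0] (eqConst c) (by decide)

theorem eqConst_even {c : ℕ} (h0 : c ≠ 0) (h : c % 2 = 0) :
    eqConst c = .ex (doubleBody (c / 2)) := by
  rw [eqConst, dif_neg h0, dif_pos h]; rfl

theorem eqConst_odd {c : ℕ} (h : c % 2 ≠ 0) : eqConst c = .ex (succBody (c - 1)) := by
  rw [eqConst, dif_neg (by omega), dif_neg h]; rfl

theorem succFormula_holds (v : Fin 2 → ℕ) : succFormula.Holds v ↔ v 0 + 1 = v 1 := by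
  constructor
  · rintro ⟨n, hn, h⟩
    have hn : n = 1 := hn
    have h : v 0 + n = v 1 := h
    rw [← h, hn]
  · intro h
    exact ⟨1, rfl, h⟩

theorem eqConst_holds (c : ℕ) (v : Fin 1 → ℕ) : (eqConst c).Holds v ↔ v 0 = c := by
  induction c using Nat.strong_induction_on generalizing v with
  | _ c ih =>
    by_cases h0 : c = 0
    · subst h0; rw [eqConst_zero]; rfl
    by_cases h : c % 2 = 0
    · rw [eqConst_even h0 h]
      constructor
      · rintro ⟨n, hn, hadd⟩
        have hn : n = c / 2 := (ih (c / 2) (by omega) _).1 hn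
        have hadd : n + n = v 0 := hadd
        omega
      · intro hv
        refine ⟨c / 2, (ih (c / 2) (by omega) _).2 rfl, ?_⟩
        change c / 2 + c / 2 = v 0
        omega
    · rw [eqConst_odd h]
      constructor
      · rintro ⟨n, hn, hadd⟩
        have hn : n = c - 1 := (ih (c - 1) (by omega) _).1 hn
        have hadd : n + 1 = v 0 := (succFormula_holds _).1 hadd
        omega
      · intro hv
        refine ⟨c - 1, (ih (c - 1) (by omega) _).2 rfl, (succFormula_holds _).2 ?_⟩
        change c - 1 + 1 = v 0
        omega

theorem doubleBody_holds (c : ℕ) (v : Fin 2 → ℕ) :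
    (doubleBody c).Holds v ↔ v 0 = c ∧ ∑ i, (![2, -1] : Fin 2 → ℤ) i * (v i : ℤ) = 0 := by
  have : (doubleBody c).Holds v ↔ (eqConst c).Holds (v ∘ ![0]) ∧ v 0 + v 0 = v 1 := Iff.rfl
  rw [this, eqConst_holds, Fin.sum_univ_two]
  simp
  omega

theorem succBody_holds (c : ℕ) (v : Fin 2 → ℕ) :
    (succBody c).Holds v ↔ v 0 = c ∧ ∑ i, (![1, -1] : Fin 2 → ℤ) i * (v i : ℤ) = -1 := by
  have : (succBody c).Holds v ↔
    (eqConst c).Holds (v ∘ ![0]) ∧ succFormula.Holds (v ∘ ![0, 1]) := Iff.rfl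
  rw [this, eqConst_holds, succFormula_holds, Fin.sum_univ_two]
  simp
  omega

theorem addBody_holds (c : ℕ) (v : Fin 3 → ℕ) :
    (addBody c).Holds v ↔ v 0 = c ∧ ∑ i, (![1, 1, -1] : Fin 3 → ℤ) i * (v i : ℤ) = 0 := by
  have : (addBody c).Holds v ↔ v 1 + v 0 = v 2 ∧ (eqConst c).Holds (v ∘ ![0]) := Iff.rfl
  rw [this, eqConst_holds, Fin.sum_univ_three]
  simp
  omega

theorem addConst_holds (c : ℕ) (v : Fin 2 → ℕ) : (addConst c).Holds v ↔ v 0 + c = v 1 := by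
  constructor
  · rintro ⟨n, hadd, hn⟩
    have hadd : v 0 + n = v 1 := hadd
    have hn : n = c := (eqConst_holds c _).1 hn
    rw [← hn, hadd]
  · intro h
    exact ⟨c, h, (eqConst_holds c _).2 rfl⟩

/-- The number of states of the automaton for `x = c` is logarithmic. -/
theorem exists_bound_card_eqConst :
    ∃ K : ℕ, ∀ c, Fintype.card (compile (eqConst c)).aut.State ≤ K * (c.size + 1) := by
  -- The equations are `2y - x = 0` and `y - x = -1`, with `y` bound. No induction on `c` is needed,
  -- as each bound refers only to the constant one step below.
  obtain ⟨K₁, h₁⟩ := exists_bound_ex ![2, -1] 0 (by decide)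
  obtain ⟨K₂, h₂⟩ := exists_bound_ex ![1, -1] (-1) (by decide)
  refine ⟨Fintype.card (compile .isZero).aut.State + K₁ + K₂, fun c => ?_⟩
  by_cases h0 : c = 0
  · subst h0
    rw [eqConst_zero]
    simp only [Nat.size_zero]
    omega
  have mono : ∀ d ≤ c, ∀ K, K * (d.size + 1) ≤ K * (c.size + 1) := fun d hd K =>
    Nat.mul_le_mul_left K (Nat.succ_le_succ (Nat.size_le_size hd))
  by_cases h : c % 2 = 0
  · rw [eqConst_even h0 h]
    refine ((h₁ _ _ (doubleBody_holds _)).1.trans (mono _ (by omega) _)).trans ?_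
    gcongr
    omega
  · rw [eqConst_odd h]
    refine ((h₂ _ _ (succBody_holds _)).1.trans (mono _ (by omega) _)).trans ?_
    gcongr
    omega

/-- The time for one quantifier over a number that is fixed to be `c`. -/
theorem exists_bound_time_ex {k : ℕ} (β : Fin (k + 1) → ℤ) (γ : ℤ) (hβ : β 0 ≠ 0)
    (a b d : ℕ) : ∃ K : ℕ, ∀ (c : ℕ) (θ : Formula (k + 1)),
      (∀ v : Fin (k + 1) → ℕ, θ.Holds v ↔ v 0 = c ∧ ∑ i, β i * (v i : ℤ) = γ) →
      Fintype.card (compile θ).aut.State ≤ a * Fintype.card (compile (eqConst c)).aut.State →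
      (compile θ).time ≤ (compile (eqConst c)).time + b +
        d * quasiLinear (a * Fintype.card (compile (eqConst c)).aut.State) →
      (compile (.ex θ)).time ≤ (compile (eqConst c)).time + K * quasiLinear (c.size + 1) := by
  obtain ⟨K₁, h₁⟩ := exists_bound_ex β γ hβ
  obtain ⟨K₂, h₂⟩ := exists_bound_card_eqConst
  -- The product has at most `a * K₂ * (c.size + 1)` states; `M` is the factor that
  -- `quasiLinear_mul_le` extracts.
  set M := a * K₂ * (a * K₂ + 1) with hM
  refine ⟨b + d * M + K₁ * M + K₁, fun c θ hθ hcard htime => ?_⟩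
  have h := (h₁ c θ hθ).2
  have hq : quasiLinear (a * Fintype.card (compile (eqConst c)).aut.State) ≤
      M * quasiLinear (c.size + 1) := by
    refine le_trans (quasiLinear_mono ?_) (quasiLinear_mul_le (a * K₂) (c.size + 1))
    rw [mul_assoc]
    exact Nat.mul_le_mul_left a (h₂ c)
  have hq' := (quasiLinear_mono hcard).trans hq
  have h1 : 1 ≤ quasiLinear (c.size + 1) := (Nat.le_add_left 1 _).trans (le_quasiLinear _)
  have e1 := Nat.mul_le_mul_left d hq
  have e2 := Nat.mul_le_mul_left K₁ hq'
  have e3 := Nat.mul_le_mul_left b h1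
  rw [← mul_assoc] at e1 e2
  rw [add_mul, add_mul, add_mul]
  omega

/-- The quantity `2 * c.size + c % 2` bounds the recursion depth: halving removes a binary digit and
raises the parity by at most one, and subtracting one from an odd number clears the parity. -/
theorem exists_bound_time_eqConst : ∃ K : ℕ, ∀ c,
    (compile (eqConst c)).time ≤ K * (2 * c.size + c % 2 + 1) * quasiLinear (c.size + 1) := by
  obtain ⟨K₁, h₁⟩ := exists_bound_time_ex ![2, -1] 0 (by decide)
    (Fintype.card (compile .add).aut.State) (compile .add).time (6 * 2 ^ 2)
  obtain ⟨K₂, h₂⟩ := exists_bound_time_ex ![1, -1] (-1) (by decide)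
    (Fintype.card (compile succFormula).aut.State) (compile succFormula).time (6 * 2 ^ 2)
  refine ⟨(compile .isZero).time + K₁ + K₂, fun c => ?_⟩
  generalize hK : (compile .isZero).time + K₁ + K₂ = K
  induction c using Nat.strong_induction_on with
  | _ c ih =>
    by_cases h0 : c = 0
    · subst h0
      rw [eqConst_zero]
      simp only [Nat.size_zero, quasiLinear]
      simp
      omega
    have step : ∀ d < c, 2 * d.size + d % 2 + 1 + 1 ≤ 2 * c.size + c % 2 + 1 → ∀ K' ≤ K, ∀ t,
        t ≤ (compile (eqConst d)).time + K' * quasiLinear (d.size + 1) →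
        t ≤ K * (2 * c.size + c % 2 + 1) * quasiLinear (c.size + 1) := by
      intro d hd hs K' hK' t ht
      have hq : quasiLinear (d.size + 1) ≤ quasiLinear (c.size + 1) :=
        quasiLinear_mono (Nat.succ_le_succ (Nat.size_le_size hd.le))
      calc t ≤ K * (2 * d.size + d % 2 + 1) * quasiLinear (d.size + 1) +
            K * quasiLinear (d.size + 1) :=
            ht.trans (add_le_add (ih d hd) (Nat.mul_le_mul_right _ hK'))
        _ = K * (2 * d.size + d % 2 + 1 + 1) * quasiLinear (d.size + 1) := by ring
        _ ≤ _ := by gcongr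
    by_cases h : c % 2 = 0
    · rw [eqConst_even h0 h]
      refine step (c / 2) (by omega) ?_ K₁ (by omega) _ (h₁ _ _ (doubleBody_holds _) ?_ ?_)
      · have : c.size = (c / 2).size + 1 := by
          conv_lhs => rw [show c = Nat.bit false (c / 2) by simp [Nat.bit]; omega]
          rw [Nat.size_bit (by simp [Nat.bit]; omega)]
        omega
      · rw [doubleBody, compile, mul_comm]
        exact card_conjStep_le _ _ _ _
      · rw [doubleBody, compile, mul_comm (Fintype.card _)]
        exact conjStep_time_le _ _ _ _
    · rw [eqConst_odd h]
      refine step (c - 1) (by omega) ?_ K₂ (by omega) _ (h₂ _ _ (succBody_holds _) ?_ ?_)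
      · have := Nat.size_le_size (show c - 1 ≤ c by omega)
        omega
      · rw [succBody, compile, mul_comm]
        exact card_conjStep_le _ _ _ _
      · rw [succBody, compile, mul_comm (Fintype.card _)]
        exact conjStep_time_le _ _ _ _

/-- One more quantifier, for the equation `y + x - z = 0`, costs no more than a single step of the
recursion for `eqConst c`, up to a constant. -/
theorem exists_bound_time_addConst : ∃ K : ℕ, ∀ c,
    (compile (addConst c)).time ≤ K * (c.size + 1) ^ 2 * (Nat.log 2 (c.size + 1) + 1) := by
  obtain ⟨K₁, h₁⟩ := exists_bound_time_ex ![1, 1, -1] 0 (by decide)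
    (Fintype.card (compile .add).aut.State) (compile .add).time (6 * 2 ^ 3)
  obtain ⟨K₂, h₂⟩ := exists_bound_time_eqConst
  refine ⟨2 * K₂ + K₁, fun c => ?_⟩
  have h := h₁ c (addBody c) (addBody_holds c)
    (by rw [addBody, compile]; exact card_conjStep_le _ _ _ _)
    (by
      rw [addBody, compile, add_comm (compile (eqConst c)).time]
      exact conjStep_time_le _ _ _ _)
  refine (h.trans (Nat.add_le_add_right (h₂ c) _)).trans ?_
  have hc : 2 * c.size + c % 2 + 1 ≤ 2 * (c.size + 1) := by omega
  have e1 : K₂ * (2 * c.size + c % 2 + 1) * quasiLinear (c.size + 1) ≤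
      K₂ * (2 * (c.size + 1)) * quasiLinear (c.size + 1) := by gcongr
  have e2 : K₁ * quasiLinear (c.size + 1) ≤ K₁ * (c.size + 1) * quasiLinear (c.size + 1) := by
    gcongr
    exact Nat.le_mul_of_pos_right _ (Nat.succ_pos _)
  refine (add_le_add e1 e2).trans (le_of_eq ?_)
  unfold quasiLinear
  ring

/-! ### Logarithms -/

/-- From `2 ^ (c.size - 1) ≤ c`, the size is at most `1 + log c / log 2`, and `1 / log 2 < 2`. -/
theorem size_add_one_le (c : ℕ) : ((c.size + 1 : ℕ) : ℝ) ≤ 4 * max 1 (Real.log c) := by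
  have hl := Real.log_two_gt_d9
  have h1 := le_max_left 1 (Real.log c)
  have h2 := le_max_right 1 (Real.log c)
  rcases c.eq_zero_or_pos with rfl | hc
  · simp
  have hs : 0 < c.size := Nat.size_pos.2 hc
  have hp : 2 ^ (c.size - 1) ≤ c := Nat.lt_size.1 (by omega)
  have hp' : (2 : ℝ) ^ (c.size - 1) ≤ c := by exact_mod_cast hp
  have := Real.log_le_log (by positivity) hp'
  rw [Real.log_pow, Nat.cast_sub hs] at this
  push_cast at this ⊢
  have hs' : (1 : ℝ) ≤ c.size := by exact_mod_cast hs
  nlinarith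

theorem log_size_add_one_le (c : ℕ) : ((Nat.log 2 (c.size + 1) + 1 : ℕ) : ℝ) ≤
    5 * max 1 (Real.log (Real.log c)) := by
  have hl := Real.log_two_gt_d9
  have h1 := le_max_left 1 (Real.log (Real.log c))
  have h2 := le_max_right 1 (Real.log (Real.log c))
  have hL : Real.log (max 1 (Real.log c)) ≤ max 1 (Real.log (Real.log c)) := by
    rcases le_total 1 (Real.log c) with h | h
    · rwa [max_eq_right h]
    · rw [max_eq_left h, Real.log_one]; linarith
  have hp : 2 ^ Nat.log 2 (c.size + 1) ≤ c.size + 1 := Nat.pow_log_le_self 2 (by omega)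
  have hp' : (2 : ℝ) ^ Nat.log 2 (c.size + 1) ≤ 2 ^ 2 * max 1 (Real.log c) := by
    have : (2 : ℝ) ^ Nat.log 2 (c.size + 1) ≤ (c.size + 1 : ℕ) := by exact_mod_cast hp
    have := this.trans (size_add_one_le c)
    linarith
  have hpos : 0 < max 1 (Real.log c) := lt_max_of_lt_left one_pos
  have := Real.log_le_log (by positivity) hp'
  rw [Real.log_mul (by positivity) hpos.ne', Real.log_pow, Real.log_pow] at this
  push_cast at this ⊢
  nlinarith

end FibBuchi

/-! ### The main theorem -/

theorem theorem18 :
    ∃ C : ℝ, ∀ c : ℕ,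
      (∀ v : Fin 2 → ℕ, (FibBuchi.addConst c).Holds v ↔ v 0 + c = v 1) ∧
      (FibBuchi.compile (FibBuchi.addConst c)).aut.dfa.accepts =
        {w : List (Fin 2 → Bool) |
          FibBuchi.IsFibRep (FibBuchi.track 0 w) ∧ FibBuchi.IsFibRep (FibBuchi.track 1 w) ∧
          FibBuchi.fibVal (FibBuchi.track 0 w) + c = FibBuchi.fibVal (FibBuchi.track 1 w)} ∧
      (∀ (σ : Type) [Fintype σ] (M : DFA (Fin 2 → Bool) σ),
        M.accepts = (FibBuchi.compile (FibBuchi.addConst c)).aut.dfa.accepts →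
        Fintype.card (FibBuchi.compile (FibBuchi.addConst c)).aut.State ≤ Fintype.card σ) ∧
      ((FibBuchi.compile (FibBuchi.addConst c)).time : ℝ) ≤
        C * (max 1 (Real.log c)) ^ 2 * max 1 (Real.log (Real.log c)) := by
  obtain ⟨K, hK⟩ := FibBuchi.exists_bound_time_addConst
  -- The factor is `80 = 4 ^ 2 * 5`, from the two logarithm estimates.
  refine ⟨K * 80, fun c => ⟨FibBuchi.addConst_holds c, ?_, ?_, ?_⟩⟩
  · ext w
    rw [FibBuchi.mem_compile_accepts, FibBuchi.addConst_holds, FibBuchi.ValidTracks,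
      Fin.forall_fin_two, and_assoc]
    rfl
  · intro σ _ M hM
    exact (FibBuchi.compile_isMinimal _).card_le hM
  · have h : ((FibBuchi.compile (FibBuchi.addConst c)).time : ℝ) ≤
        K * ((c.size + 1 : ℕ) : ℝ) ^ 2 * ((Nat.log 2 (c.size + 1) + 1 : ℕ) : ℝ) := by
      exact_mod_cast hK c
    calc _ ≤ _ := h
      _ ≤ K * (4 * max 1 (Real.log c)) ^ 2 * (5 * max 1 (Real.log (Real.log c))) := by
        gcongr
        · exact FibBuchi.size_add_one_le c
        · exact FibBuchi.log_size_add_one_le c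
      _ = _ := by ring
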